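/- A transition graph is a tuple $G=(V,s,t,E,\ell)$, where $V$ and $E$ are the finite sets of vertices and edges of a directed graph (loops and multiple edges are allowed), $s,t\in V$ are the start and the terminal vertex, and $\ell\colon E\to\{\varnothing\}\cup U$ labels every edge by an element of a finite set $U$ or by the empty label $\varnothing$. The label set $\ell(P)$ of a path $P$ (vertices and edges may repeat; the path of length zero is allowed if $s=t$) is the set of all non-empty labels of its edges, and $\mathcal F(G)=\{\ell(P): P \text{ is a path from } s \text{ to } t\}$. **Next-label problem.** Input: a transition graph $G$ and a finite family $\mathcal S\subseteq\mathcal F(G)$. The graph is given by the list of its vertices, the vertices $s$ and $t$, and the list of its edges with their end-points and labels; $\mathcal S$ is given by the list of its members, each a list of labels; all names are binary numerals. Task: decide whether $\mathcal F(G)=\mathcal S$ and, if not, output (as a list of its elements) a set in $\mathcal F(G)\setminus\mathcal S$. **Lemma.** The Next-label problem can be solved in polynomial time: there are a (multi-stack) Turing machine and a polynomial $q$ such that on every input $(G,\mathcal S)$ whose encoding has length $N$ the machine halts after at most $q(N)$ steps with a correct answer. -/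

import Mathlib

/-- A transition graph `(V, s, t, E, ℓ)`: a directed graph, loops and multiple edges allowed, with
a start vertex, a terminal vertex, and edges labelled by elements of `U` or by the empty label
(`none`). -/
structure TransitionGraph (V E U : Type*) where
  start : V
  terminal : V
  src : E → V
  tgt : E → V
  label : E → Option U

namespace TransitionGraph

variable {V E U : Type*}

/-- `G.IsPath v p w`: the list of edges `p` is a path from `v` to `w`. Vertices and edges may
repeat, and the empty list is a path from every vertex to itself. -/
inductive IsPath (G : TransitionGraph V E U) : V → List E → V → Prop
  | nil (v : V) : IsPath G v [] v
  | cons (e : E) (p : List E) (w : V) (h : IsPath G (G.tgt e) p w) : IsPath G (G.src e) (e :: p) w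

/-- The set of all non-empty labels of the edges of a path. -/
def labelSet [DecidableEq U] (G : TransitionGraph V E U) (p : List E) : Finset U :=
  (p.filterMap G.label).toFinset

/-- The family `F(G)` of the label sets of all paths from the start to the terminal vertex. -/
def labelFamily [DecidableEq U] (G : TransitionGraph V E U) : Set (Finset U) :=
  {X | ∃ p, G.IsPath G.start p G.terminal ∧ G.labelSet p = X}

end TransitionGraph

/-- The family of finite sets presented by a list of lists. -/
def familyOfLists (L : List (List ℕ)) : Set (Finset ℕ) :=
  {X | ∃ l ∈ L, l.toFinset = X}

/-- An instance of the Next-label problem: a finite transition graph, with vertices and edges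
numbered from `0` and with natural numbers as names of labels, and a family `S` of label sets with
`S ⊆ F(G)`, each set given by a list of its elements. -/
structure NextLabelInput where
  numVertices : ℕ
  numEdges : ℕ
  graph : TransitionGraph (Fin numVertices) (Fin numEdges) ℕ
  sets : List (List ℕ)
  sets_subset : familyOfLists sets ⊆ graph.labelFamily

/-- Correct answers to an instance: `none` states that `F(G) = S`; `some l` presents an element of
`F(G) \ S` by a list of its elements. -/
def NextLabelInput.IsAnswer (I : NextLabelInput) : Option (List ℕ) → Prop
  | none => I.graph.labelFamily = familyOfLists I.sets
  | some l => l.toFinset ∈ I.graph.labelFamily \ familyOfLists I.sets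

/-- The alphabet in which inputs and outputs are written. -/
inductive CodeSymbol
  | zero
  | one
  | comma
  | semicolon
  | bar
  | empty
  deriving DecidableEq

instance : Fintype CodeSymbol where
  elems := {.zero, .one, .comma, .semicolon, .bar, .empty}
  complete x := by cases x <;> decide

/-- The binary numeral of `n`, least significant bit first; the numeral of `0` is the empty word. -/
def codeNat (n : ℕ) : List CodeSymbol :=
  (Computability.encodeNat n).map fun b => if b then CodeSymbol.one else CodeSymbol.zero

/-- A list of natural numbers: binary numerals, each followed by a comma. -/
def codeList (l : List ℕ) : List CodeSymbol :=
  l.flatMap fun n => codeNat n ++ [CodeSymbol.comma]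

/-- An edge label. -/
def codeLabel : Option ℕ → List CodeSymbol
  | none => [CodeSymbol.empty]
  | some u => codeNat u

/-- A transition graph: the list of vertices, the start and the terminal vertex, and the table that
gives the source, the target and the label of every edge. -/
def codeGraph {n k : ℕ} (G : TransitionGraph (Fin n) (Fin k) ℕ) : List CodeSymbol :=
  codeList (List.range n) ++ [CodeSymbol.bar] ++
    codeList [(G.start : ℕ), (G.terminal : ℕ)] ++ [CodeSymbol.bar] ++
    (List.finRange k).flatMap
      (fun e => codeList [(G.src e : ℕ), (G.tgt e : ℕ)] ++
        codeLabel (G.label e) ++ [CodeSymbol.comma]) ++ [CodeSymbol.bar]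

/-- An instance of the Next-label problem: the graph followed by the sets of the family, each of
them terminated by a semicolon. -/
def NextLabelInput.code (I : NextLabelInput) : List CodeSymbol :=
  codeGraph I.graph ++ I.sets.flatMap fun l => codeList l ++ [CodeSymbol.semicolon]

/-- An output: a single special symbol for `none`, and the list of the elements of the set
otherwise. -/
def codeAnswer : Option (List ℕ) → List CodeSymbol
  | none => [CodeSymbol.empty]
  | some l => codeList l

/-! Counting replaces search. If two prefixes of a path end at the same vertex and have seen equally
many labels, the segment between them can be cut out without changing the label set. So every label
set occurs on a path of length at most `L = |V| (|E| + 1)` (`exists_short_path`), and an unlabelled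
loop added at the terminal vertex turns such paths into walks of length exactly `L`
(`mem_walkSets_iff`). Let `c(W)` be the number of these walks with all labels in `W`, and `e(A)` the
number of those with label set exactly `A`. Dynamic programming gives `c(W)` (`walkCount_eq`).
Moreover `e(A)` is `c(A)` minus the sum of `e(B)` over the proper subsets `B` of `A`. If all label
sets properly inside `A` belong to `S`, only `B` in `S` matter, and `e` can be found on such sets by
recursion on cardinality (`foldl_refineTable_eq`). Call `W` deficient if `c(W)` differs from the sum
of the table entries of the members of `S` inside `W`. When these entries are right, this says that
some label set inside `W` is missing from `S` (`deficient_iff`).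

Entries may be wrong for members of `S` that properly contain a missing set. Therefore one descends:
from the set of all labels, pass to a deficient set of the form `W - u` or `A - u` with `A` in `S`
and `A ⊆ W`, as long as there is one. At the final `W` all entries below `W` are right: if `A` is a
smallest counterexample, with missing `Y` properly inside it, delete some `u` in `A \ Y`. The
entries below `A - u` are right, so `A - u` is deficient, contrary to finality. If the final `W` is
deficient, it contains a missing set, which is `W` itself, since otherwise some `W - u` would be
deficient. If it is not deficient, no step was ever taken, so `W` consists of all labels and nothing
is missing (`answer_correct`).

For the running time, data are binary trees in prefix code on a stack. `PolyTime` is closed under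
composition, pairing, case distinction, and iteration along a list with polynomially bounded
intermediate sizes (`PolyTime.foldl`). Walk numbers have polynomially many bits, which bounds all
tables. Programs translate step for step into `TM2` machines (`Runs.steps`). -/

/-! ## Structured programs on stacks and their compilation to `TM2` machines -/

namespace StackProgram

open Function (update)
open Turing (TM2.Stmt TM2.stepAux TM2.step)

/-- The stacks of the machine: one for input and output, one that holds the values in work, and
three scratch stacks. -/
inductive Stack
  | io
  | main
  | left
  | right
  | count
  deriving DecidableEq

instance : Fintype Stack where
  elems := {.io, .main, .left, .right, .count}
  complete x := by cases x <;> decide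

/-- The contents of the stacks. -/
abbrev Store := Stack → List CodeSymbol

/-- Structured programs. `move k ks` takes the top symbol of `k`, if there is one, and pushes a copy
of it on each of the stacks `ks`. -/
inductive Cmd
  | skip
  | push (k : Stack) (a : CodeSymbol)
  | move (k : Stack) (ks : List Stack)
  | seq (c d : Cmd)
  | ite (k : Stack) (p : Option CodeSymbol → Bool) (c d : Cmd)
  | loop (k : Stack) (p : Option CodeSymbol → Bool) (c : Cmd)

/-- Push a symbol on each stack of a list. -/
def pushAll (a : CodeSymbol) : List Stack → Store → Store
  | [], s => s
  | k :: ks, s => pushAll a ks (update s k (a :: s k))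

/-- `Runs c s s' n`: the program `c`, started with the stacks `s`, stops after `n` steps with the
stacks `s'`. -/
inductive Runs : Cmd → Store → Store → ℕ → Prop
  | skip (s) : Runs .skip s s 1
  | push (k a s) : Runs (.push k a) s (update s k (a :: s k)) 1
  | move_nil (k ks s) : s k = [] → Runs (.move k ks) s s 1
  | move_cons (k ks s a l) : s k = a :: l → Runs (.move k ks) s (pushAll a ks (update s k l)) 1
  | seq {c d s s' s'' n m} : Runs c s s' n → Runs d s' s'' m → Runs (.seq c d) s s'' (n + m)
  | ite_true {k p c d s s' n} : p (s k).head? = true → Runs c s s' n →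
      Runs (.ite k p c d) s s' (n + 1)
  | ite_false {k p c d s s' n} : p (s k).head? = false → Runs d s s' n →
      Runs (.ite k p c d) s s' (n + 1)
  | loop_exit {k p c s} : p (s k).head? = false → Runs (.loop k p c) s s 1
  | loop_step {k p c s s' s'' n m} : p (s k).head? = true → Runs c s s' n →
      Runs (.loop k p c) s' s'' m → Runs (.loop k p c) s s'' (n + m + 1)

/-- The program points of a program. -/
def Cmd.Point : Cmd → Type
  | .skip => Unit
  | .push _ _ => Unit
  | .move _ _ => Unit
  | .seq c d => c.Point ⊕ d.Point
  | .ite _ _ c d => Option (c.Point ⊕ d.Point)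
  | .loop _ _ c => Option c.Point

/-- There are finitely many program points. -/
@[reducible] def Cmd.pointFintype : (c : Cmd) → Fintype c.Point
  | .skip => inferInstanceAs (Fintype Unit)
  | .push _ _ => inferInstanceAs (Fintype Unit)
  | .move _ _ => inferInstanceAs (Fintype Unit)
  | .seq c d =>
    letI := c.pointFintype
    letI := d.pointFintype
    inferInstanceAs (Fintype (c.Point ⊕ d.Point))
  | .ite _ _ c d =>
    letI := c.pointFintype
    letI := d.pointFintype
    inferInstanceAs (Fintype (Option (c.Point ⊕ d.Point)))
  | .loop _ _ c =>
    letI := c.pointFintype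
    inferInstanceAs (Fintype (Option c.Point))

/-- The first program point of a program. -/
def Cmd.entry : (c : Cmd) → c.Point
  | .skip => ()
  | .push _ _ => ()
  | .move _ _ => ()
  | .seq c _ => Sum.inl c.entry
  | .ite _ _ _ _ => none
  | .loop _ _ _ => none

/-! ### Compilation of programs to `TM2` machines -/

section Compile

variable {Λ : Type}

/-- The statements of the target machine. Its internal state holds at most one symbol. -/
abbrev Code (Λ : Type) := TM2.Stmt (fun _ : Stack => CodeSymbol) Λ (Option CodeSymbol)

/-- Go to a label, or halt. -/
def jump : Option Λ → Code Λ
  | some l => .goto fun _ => l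
  | none => .halt

/-- Push the stored symbol on each stack of a list and forget it. -/
def pushCode : List Stack → Code Λ → Code Λ
  | [], q => .load (fun _ => none) q
  | k :: ks, q => .push k (fun v => v.getD .empty) (pushCode ks q)

/-- The statement of a program point; `emb` places the program points among the labels of the
target machine, and `exit` says where to go when the program stops. -/
def Cmd.code : (c : Cmd) → (emb : c.Point → Λ) → (exit : Option Λ) → c.Point → Code Λ
  | .skip, _, exit, _ => jump exit
  | .push k a, _, exit, _ => .push k (fun _ => a) (jump exit)
  | .move k ks, _, exit, _ =>
      .pop k (fun _ o => o) (.branch Option.isSome (pushCode ks (jump exit)) (jump exit))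
  | .seq c d, emb, exit, l =>
      match l with
      | Sum.inl l => c.code (fun l => emb (Sum.inl l)) (some (emb (Sum.inr d.entry))) l
      | Sum.inr l => d.code (fun l => emb (Sum.inr l)) exit l
  | .ite k p c d, emb, exit, l =>
      match l with
      -- Clearing the internal state after each test keeps all configurations between program points
      -- of the form `cfg`.
      | none => .peek k (fun _ o => o) (.branch p
          (.load (fun _ => none) (jump (some (emb (some (Sum.inl c.entry))))))
          (.load (fun _ => none) (jump (some (emb (some (Sum.inr d.entry)))))))
      | some (Sum.inl l) => c.code (fun l => emb (some (Sum.inl l))) exit l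
      | some (Sum.inr l) => d.code (fun l => emb (some (Sum.inr l))) exit l
  | .loop k p c, emb, exit, l =>
      match l with
      | none => .peek k (fun _ o => o) (.branch p
          (.load (fun _ => none) (jump (some (emb (some c.entry)))))
          (.load (fun _ => none) (jump exit)))
      | some l => c.code (fun l => emb (some l)) (some (emb none)) l

/-- A configuration with empty internal state. -/
abbrev cfg (l : Option Λ) (s : Store) :
    Turing.TM2.Cfg (fun _ : Stack => CodeSymbol) Λ (Option CodeSymbol) := ⟨l, none, s⟩

/-- The machine `M` gets from one configuration to another one in `n` steps. -/
def Steps (M : Λ → Code Λ) (n : ℕ) (l : Option Λ) (s : Store) (l' : Option Λ) (s' : Store) : Prop :=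
  (flip bind (TM2.step M))^[n] (some (cfg l s)) = some (cfg l' s')

theorem Steps.trans {M : Λ → Code Λ} {n m : ℕ} {l l' l'' : Option Λ} {s s' s'' : Store}
    (h : Steps M n l s l' s') (h' : Steps M m l' s' l'' s'') : Steps M (n + m) l s l'' s'' := by
  unfold Steps at *
  rw [add_comm, Function.iterate_add_apply, h, h']

theorem Steps.one {M : Λ → Code Λ} {l : Λ} {l' : Option Λ} {s s' : Store}
    (h : TM2.stepAux (M l) none s = cfg l' s') : Steps M 1 (some l) s l' s' := by
  simp [Steps, flip, h]

theorem stepAux_jump (o : Option Λ) (s : Store) : TM2.stepAux (jump o) none s = cfg o s := by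
  cases o <;> rfl

theorem stepAux_pushCode (a : CodeSymbol) (ks : List Stack) (q : Code Λ) (s : Store) :
    TM2.stepAux (pushCode ks q) (some a) s = TM2.stepAux q none (pushAll a ks s) := by
  induction ks generalizing s with
  | nil => rfl
  | cons k ks ih => exact ih _

/-- Each program point takes a single machine step, so the step counts agree exactly. The arbitrary
`emb` and `exit` let the induction treat a subprogram inside the machine of the whole program. -/
theorem Runs.steps {c : Cmd} {s s' : Store} {n : ℕ} (h : Runs c s s' n) {M : Λ → Code Λ}
    (emb : c.Point → Λ) (exit : Option Λ) (hM : ∀ l, M (emb l) = c.code emb exit l) :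
    Steps M n (some (emb c.entry)) s exit s' := by
  induction h generalizing exit with
  | skip s =>
    exact Steps.one ((congrArg (fun q => TM2.stepAux q none s) (hM _)).trans (stepAux_jump _ _))
  | push k a s =>
    exact Steps.one ((congrArg (fun q => TM2.stepAux q none s) (hM _)).trans (stepAux_jump _ _))
  | move_nil k ks s h =>
    refine Steps.one ((congrArg (fun q => TM2.stepAux q none s) (hM _)).trans ?_)
    simp [Cmd.code, h, stepAux_jump]
  | move_cons k ks s a l h =>
    refine Steps.one ((congrArg (fun q => TM2.stepAux q none s) (hM _)).trans ?_)
    simp [Cmd.code, h, stepAux_jump, stepAux_pushCode]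
  | @seq c d s s' s'' n m _ _ ih₁ ih₂ =>
    exact (ih₁ (fun l => emb (Sum.inl l)) (some (emb (Sum.inr d.entry)))
      fun l => hM (Sum.inl l)).trans (ih₂ (fun l => emb (Sum.inr l)) exit fun l => hM (Sum.inr l))
  | @ite_true k p c d s s' n h _ ih =>
    rw [add_comm]
    refine Steps.trans (Steps.one (l' := some (emb (some (Sum.inl c.entry)))) (s' := s) ?_)
      (ih (fun l => emb (some (Sum.inl l))) exit fun l => hM (some (Sum.inl l)))
    rw [hM]
    simp [Cmd.code, Cmd.entry, h, stepAux_jump]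
  | @ite_false k p c d s s' n h _ ih =>
    rw [add_comm]
    refine Steps.trans (Steps.one (l' := some (emb (some (Sum.inr d.entry)))) (s' := s) ?_)
      (ih (fun l => emb (some (Sum.inr l))) exit fun l => hM (some (Sum.inr l)))
    rw [hM]
    simp [Cmd.code, Cmd.entry, h, stepAux_jump]
  | @loop_exit k p c s h =>
    refine Steps.one ?_
    rw [hM]
    simp [Cmd.code, Cmd.entry, h, stepAux_jump]
  | @loop_step k p c s s' s'' n m h _ _ ih₁ ih₂ =>
    rw [add_comm]
    refine Steps.trans (Steps.one (l' := some (emb (some c.entry))) (s' := s) ?_)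
      ((ih₁ (fun l => emb (some l)) (some (emb none)) fun l => hM (some l)).trans
        (ih₂ emb exit hM))
    rw [hM]
    simp [Cmd.code, Cmd.entry, h, stepAux_jump]

end Compile

/-- The machine that runs a program. -/
def Cmd.machine (c : Cmd) : Turing.FinTM2 :=
  letI := c.pointFintype
  { K := Stack
    k₀ := .io
    k₁ := .io
    Γ := fun _ => CodeSymbol
    Λ := c.Point
    main := c.entry
    σ := Option CodeSymbol
    initialState := none
    Γk₀Fin := inferInstanceAs (Fintype CodeSymbol)
    m := c.code id none }

/-- The stacks given one by one. -/
def store (io main left right count : List CodeSymbol) : Store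
  | .io => io
  | .main => main
  | .left => left
  | .right => right
  | .count => count

section store

variable (i m a b c l : List CodeSymbol)

@[simp] theorem store_io : store i m a b c .io = i := rfl
@[simp] theorem store_main : store i m a b c .main = m := rfl
@[simp] theorem store_left : store i m a b c .left = a := rfl
@[simp] theorem store_right : store i m a b c .right = b := rfl
@[simp] theorem store_count : store i m a b c .count = c := rfl

@[simp] theorem update_store_io : update (store i m a b c) .io l = store l m a b c := by
  funext k; cases k <;> rfl
@[simp] theorem update_store_main : update (store i m a b c) .main l = store i l a b c := by
  funext k; cases k <;> rfl
@[simp] theorem update_store_left : update (store i m a b c) .left l = store i m l b c := by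
  funext k; cases k <;> rfl
@[simp] theorem update_store_right : update (store i m a b c) .right l = store i m a l c := by
  funext k; cases k <;> rfl
@[simp] theorem update_store_count : update (store i m a b c) .count l = store i m a b l := by
  funext k; cases k <;> rfl

end store

/-- A program that transforms the contents of the input and output stack in polynomial time
computes a function in polynomial time in the sense of `TM2` machines. -/
theorem computable_of_runs {α β : Type} (ea : α → List CodeSymbol) (eb : β → List CodeSymbol)
    (f : α → β) (c : Cmd) (p : Polynomial ℕ)
    (h : ∀ a, ∃ n ≤ p.eval (ea a).length,
      Runs c (store (ea a) [] [] [] []) (store (eb (f a)) [] [] [] []) n) :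
    Nonempty (Turing.TM2ComputableInPolyTime ea eb f) := by
  refine ⟨{ tm := c.machine, inputAlphabet := Equiv.refl _, outputAlphabet := Equiv.refl _,
            time := p, outputsFun := fun a => ?_ }⟩
  have hn := (h a).choose_spec
  refine ⟨⟨(h a).choose, ?_⟩, hn.1⟩
  have key := hn.2.steps (M := c.code id none) id none fun l => rfl
  have e : ∀ l : List CodeSymbol,
      (fun k : Stack => if k = .io then l else []) = store l [] [] [] [] := by
    intro l; funext k; cases k <;> rfl
  have e₁ : Turing.initList c.machine (List.map (Equiv.refl CodeSymbol).invFun (ea a)) =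
      cfg (some c.entry) (store (ea a) [] [] [] []) := by
    rw [← e]
    simp only [Turing.initList, cfg]
    congr 1
    funext k
    cases k with
    | io => simp [Cmd.machine]; rfl
    | _ => rfl
  have e₂ : Turing.haltList c.machine (List.map (Equiv.refl CodeSymbol).invFun (eb (f a))) =
      cfg none (store (eb (f a)) [] [] [] []) := by
    rw [← e]
    simp only [Turing.haltList, cfg]
    congr 1
    funext k
    cases k with
    | io => simp [Cmd.machine]; rfl
    | _ => rfl
  refine Eq.trans ?_ (Eq.trans key ?_)
  · exact congrArg _ (congrArg some e₁)
  · exact (congrArg some e₂).symm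

end StackProgram

/-! ## Polynomial-time functions on encoded data -/

namespace StackProgram

open Function (update)

/-- `RunsLe c s s' n`: the program `c` leads from `s` to `s'` in at most `n` steps. -/
def RunsLe (c : Cmd) (s s' : Store) (n : ℕ) : Prop := ∃ m ≤ n, Runs c s s' m

theorem Runs.le {c : Cmd} {s s' : Store} {m n : ℕ} (h : Runs c s s' m) (hn : m ≤ n) :
    RunsLe c s s' n := ⟨m, hn, h⟩

theorem RunsLe.mono {c : Cmd} {s s' : Store} {m n : ℕ} (h : RunsLe c s s' m) (hn : m ≤ n) :
    RunsLe c s s' n := let ⟨k, hk, hr⟩ := h; ⟨k, hk.trans hn, hr⟩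

theorem RunsLe.seq {c d : Cmd} {s s' s'' : Store} {m n : ℕ} (h : RunsLe c s s' m)
    (h' : RunsLe d s' s'' n) : RunsLe (.seq c d) s s'' (m + n) :=
  let ⟨_, hk, hr⟩ := h; let ⟨_, hk', hr'⟩ := h'; ⟨_, add_le_add hk hk', hr.seq hr'⟩

theorem RunsLe.ite_true {c d : Cmd} {k p} {s s' : Store} {n : ℕ} (hp : p (s k).head? = true)
    (h : RunsLe c s s' n) : RunsLe (.ite k p c d) s s' (n + 1) :=
  let ⟨_, hk, hr⟩ := h; ⟨_, Nat.succ_le_succ hk, .ite_true hp hr⟩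

theorem RunsLe.ite_false {c d : Cmd} {k p} {s s' : Store} {n : ℕ} (hp : p (s k).head? = false)
    (h : RunsLe d s s' n) : RunsLe (.ite k p c d) s s' (n + 1) :=
  let ⟨_, hk, hr⟩ := h; ⟨_, Nat.succ_le_succ hk, .ite_false hp hr⟩

theorem RunsLe.loop_step {c : Cmd} {k p} {s s' s'' : Store} {n m : ℕ} (hp : p (s k).head? = true)
    (h : RunsLe c s s' n) (h' : RunsLe (.loop k p c) s' s'' m) :
    RunsLe (.loop k p c) s s'' (n + m + 1) :=
  let ⟨_, hk, hr⟩ := h; let ⟨_, hk₁, hr₁⟩ := h'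
  ⟨_, Nat.succ_le_succ (add_le_add hk hk₁), .loop_step hp hr hr₁⟩

/-- A bound for the number of symbols that a program pushes on a stack in one step. -/
def Cmd.width : Cmd → ℕ
  | .skip => 0
  | .push _ _ => 1
  | .move _ ks => ks.length
  | .seq c d => c.width + d.width
  | .ite _ _ c d => c.width + d.width
  | .loop _ _ c => c.width

theorem length_pushAll (a : CodeSymbol) (ks : List Stack) (s : Store) (k : Stack) :
    (pushAll a ks s k).length ≤ (s k).length + ks.length := by
  induction ks generalizing s with
  | nil => simp [pushAll]
  | cons k' ks ih =>
    refine (ih _).trans ?_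
    by_cases h : k = k'
    · subst h; simp; omega
    · simp [h]

/-- Time bounds the growth of every stack; this turns running times into size bounds. -/
theorem Runs.length_le {c : Cmd} {s s' : Store} {n : ℕ} (h : Runs c s s' n) (k : Stack) :
    (s' k).length ≤ (s k).length + c.width * n := by
  induction h with
  | skip s => simp
  | push k' a s =>
    by_cases h : k = k'
    · subst h; simp [Cmd.width]
    · simp [h]
  | move_nil => simp
  | move_cons k' ks s a l h =>
    refine (length_pushAll _ _ _ _).trans ?_
    by_cases h' : k = k'
    · subst h'; simp [Cmd.width, h]
    · simp [h', Cmd.width]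
  | seq _ _ ih₁ ih₂ => simp only [Cmd.width]; nlinarith
  | ite_true _ _ ih => simp only [Cmd.width]; nlinarith
  | ite_false _ _ ih => simp only [Cmd.width]; nlinarith
  | loop_exit => simp
  | loop_step _ _ _ ih₁ ih₂ => simp only [Cmd.width] at *; nlinarith

/-! ### Trees in prefix code and elementary stack operations -/

/-- Binary trees, the data on which programs operate. -/
inductive Tree
  | leaf
  | node (a b : Tree)

/-- The prefix code of a tree. -/
def Tree.code : Tree → List CodeSymbol
  | .leaf => [.zero]
  | .node a b => .one :: (a.code ++ b.code)

/-- The number of nodes and leaves of a tree. -/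
def Tree.size : Tree → ℕ
  | .leaf => 1
  | .node a b => a.size + b.size + 1

theorem Tree.length_code (t : Tree) : t.code.length = t.size := by
  induction t with
  | leaf => rfl
  | node a b iha ihb => simp [Tree.code, Tree.size, iha, ihb]

theorem Tree.size_pos (t : Tree) : 0 < t.size := by cases t <;> simp [Tree.size]

/-- Types whose elements are encoded as trees. -/
class Enc (α : Type) where
  enc : α → Tree

open Enc (enc)

/-- The code of an element of an encoded type. -/
def code {α : Type} [Enc α] (a : α) : List CodeSymbol := (enc a).code

/-- The size of the encoding. -/
def size {α : Type} [Enc α] (a : α) : ℕ := (enc a).size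

theorem length_code {α : Type} [Enc α] (a : α) : (code a).length = size a :=
  (enc a).length_code

/-- Test for the symbol `one`. -/
def isOne : Option CodeSymbol → Bool
  | some .one => true
  | _ => false

/-- The scratch stack `l`, with the word `w` pushed on it if `x` holds. -/
def put (x : Bool) (w l : List CodeSymbol) : List CodeSymbol := if x then w.reverse ++ l else l

theorem put_cons (x : Bool) (a : CodeSymbol) (w l : List CodeSymbol) :
    put x (a :: w) l = put x w (put x [a] l) := by
  cases x <;> simp [put]

/-- The scratch stacks selected by two flags. -/
def targets (x y : Bool) : List Stack := (if x then [.left] else []) ++ (if y then [.right] else [])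

theorem pushAll_targets (x y : Bool) (a : CodeSymbol) (i m l r c : List CodeSymbol) :
    pushAll a (targets x y) (store i m l r c) = store i m (put x [a] l) (put y [a] r) c := by
  cases x <;> cases y <;> simp [targets, pushAll, put]

/-- The body of the loop that takes a tree from the main stack; the height of the stack `count`
is the number of trees that are still to be read. -/
def scanBody (x y : Bool) : Cmd :=
  .seq (.ite .main isOne (.push .count .one) (.move .count [])) (.move .main (targets x y))

/-- Take a tree from the main stack and put copies of its code on the selected scratch stacks. -/
def scan (x y : Bool) : Cmd :=
  .seq (.push .count .one) (.loop .count Option.isSome (scanBody x y))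

/-- In prefix code a `one` replaces a pending tree by two and a `zero` completes one. Since reading
a node turns one tree into two, the claim concerns a forest and the induction runs over the total
code length. The four steps per symbol are the loop test, the branch, the counter update and the
copying. -/
theorem runs_scan_loop (x y : Bool) (i rest : List CodeSymbol) (N : ℕ) :
    ∀ (ts : List Tree) (l r : List CodeSymbol), (ts.flatMap Tree.code).length = N →
    Runs (.loop .count Option.isSome (scanBody x y))
      (store i (ts.flatMap Tree.code ++ rest) l r (List.replicate ts.length .one))
      (store i rest (put x (ts.flatMap Tree.code) l) (put y (ts.flatMap Tree.code) r) [])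
      (4 * N + 1) := by
  induction N with
  | zero =>
    intro ts l r h
    have hts : ts = [] := by
      cases ts with
      | nil => rfl
      | cons t ts => have := t.size_pos; simp [Tree.length_code] at h; omega
    subst hts
    have : ∀ x l, put x [] l = l := by intro x l; cases x <;> rfl
    simp only [List.flatMap_nil, List.nil_append, this]
    exact Runs.loop_exit rfl
  | succ N ih =>
    intro ts l r h
    cases ts with
    | nil => simp at h
    | cons t ts =>
      cases t with
      | leaf =>
        have h' : (ts.flatMap Tree.code).length = N := by simpa [Tree.code] using h
        have e₁ := Runs.move_cons .count [] (store i (.zero :: (ts.flatMap Tree.code ++ rest)) l r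
          (.one :: List.replicate ts.length .one)) .one (List.replicate ts.length .one) rfl
        have e₂ := Runs.move_cons .main (targets x y)
          (store i (.zero :: (ts.flatMap Tree.code ++ rest)) l r (List.replicate ts.length .one))
          .zero (ts.flatMap Tree.code ++ rest) rfl
        rw [update_store_count, pushAll] at e₁
        rw [update_store_main, pushAll_targets] at e₂
        have := Runs.loop_step (k := .count) (p := Option.isSome) rfl
          (Runs.seq (Runs.ite_false (k := .main) (p := isOne) (c := .push .count .one) rfl e₁) e₂)
          (ih ts _ _ h')
        simp only [List.flatMap_cons, Tree.code, put_cons _ _ (List.flatMap _ _), List.cons_append,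
          List.nil_append, List.length_cons, List.replicate_succ]
        refine cast (congrArg _ ?_) this
        omega
      | node a b =>
        have h' : ((a :: b :: ts).flatMap Tree.code).length = N := by
          simp [Tree.code] at h ⊢; omega
        have e₁ := Runs.push .count .one
          (store i (.one :: ((a :: b :: ts).flatMap Tree.code ++ rest)) l r
            (.one :: List.replicate ts.length .one))
        have e₂ := Runs.move_cons .main (targets x y)
          (store i (.one :: ((a :: b :: ts).flatMap Tree.code ++ rest)) l r
            (.one :: .one :: List.replicate ts.length .one))
          .one ((a :: b :: ts).flatMap Tree.code ++ rest) rfl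
        rw [update_store_count] at e₁
        rw [update_store_main, pushAll_targets] at e₂
        have := Runs.loop_step (k := .count) (p := Option.isSome) rfl
          (Runs.seq (Runs.ite_true (k := .main) (p := isOne) (d := .move .count []) rfl e₁) e₂)
          (ih (a :: b :: ts) _ _ h')
        have e : (Tree.node a b :: ts).flatMap Tree.code =
          .one :: (a :: b :: ts).flatMap Tree.code := by simp [Tree.code]
        rw [e]
        rw [put_cons x, put_cons y]
        simp only [List.cons_append, List.length_cons, List.replicate_succ] at this ⊢
        refine cast (congrArg _ ?_) this
        omega

theorem runs_scan (x y : Bool) (i rest : List CodeSymbol) (t : Tree) (l r : List CodeSymbol) :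
    RunsLe (scan x y) (store i (t.code ++ rest) l r [])
      (store i rest (put x t.code l) (put y t.code r) []) (4 * t.size + 2) := by
  have h := runs_scan_loop x y i rest t.size [t] l r (by simp [Tree.length_code])
  simp only [List.flatMap_singleton, List.length_singleton] at h
  have e := Runs.push .count .one (store i (t.code ++ rest) l r [])
  rw [update_store_count] at e
  exact (e.seq h).le (by omega)

/-- Move all symbols from a scratch stack to the main stack. -/
def unload (k : Stack) : Cmd := .loop k Option.isSome (.move k [.main])

theorem runs_unload_left (i m w r c : List CodeSymbol) :
    Runs (unload .left) (store i m w r c) (store i (w.reverse ++ m) [] r c) (2 * w.length + 1) := by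
  induction w generalizing m with
  | nil => exact Runs.loop_exit rfl
  | cons a w ih =>
    have e := Runs.move_cons .left [.main] (store i m (a :: w) r c) a w rfl
    simp only [update_store_left, pushAll, update_store_main, store_main] at e
    have := Runs.loop_step (p := Option.isSome) rfl e (ih (a :: m))
    rw [List.reverse_cons, List.append_assoc, List.length_cons]
    refine cast (congrArg _ ?_) this
    omega

theorem runs_unload_right (i m w l c : List CodeSymbol) :
    Runs (unload .right) (store i m l w c) (store i (w.reverse ++ m) l [] c)
      (2 * w.length + 1) := by
  induction w generalizing m with
  | nil => exact Runs.loop_exit rfl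
  | cons a w ih =>
    have e := Runs.move_cons .right [.main] (store i m l (a :: w) c) a w rfl
    simp only [update_store_right, pushAll, update_store_main, store_main] at e
    have := Runs.loop_step (p := Option.isSome) rfl e (ih (a :: m))
    rw [List.reverse_cons, List.append_assoc, List.length_cons]
    refine cast (congrArg _ ?_) this
    omega

/-- The store in which all stacks but the main stack are empty. -/
abbrev vals (m : List CodeSymbol) : Store := store [] m [] [] []

/-- Remove the topmost tree. -/
def drop : Cmd := scan false false

/-- Copy the topmost tree. -/
def dup : Cmd := .seq (scan true true) (.seq (unload .left) (unload .right))

/-- Exchange the two topmost trees. -/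
def swap : Cmd :=
  .seq (scan true false) (.seq (scan false true) (.seq (unload .left) (unload .right)))

/-- Remove the topmost symbol of the main stack. -/
def pop : Cmd := .move .main []

theorem runs_drop {α : Type} [Enc α] (a : α) (rest : List CodeSymbol) :
    RunsLe drop (vals (code a ++ rest)) (vals rest) (4 * size a + 2) :=
  runs_scan false false [] rest (enc a) [] []

/-- Scanning puts the code on the scratch stacks in reverse order, and unloading reverses it again.
-/
theorem runs_dup {α : Type} [Enc α] (a : α) (rest : List CodeSymbol) :
    RunsLe dup (vals (code a ++ rest)) (vals (code a ++ (code a ++ rest))) (8 * size a + 4) := by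
  have h₁ := runs_scan true true [] rest (enc a) [] []
  have h₂ := runs_unload_left [] rest (code a).reverse (code a).reverse []
  have h₃ := runs_unload_right [] (code a ++ rest) (code a).reverse [] []
  simp only [put, if_true, List.append_nil, List.reverse_reverse, List.length_reverse,
    ← code.eq_1, ← size.eq_1, length_code] at h₁ h₂ h₃
  exact (h₁.seq ((h₂.le le_rfl).seq (h₃.le le_rfl))).mono (by omega)

theorem runs_swap {α β : Type} [Enc α] [Enc β] (a : α) (b : β) (rest : List CodeSymbol) :
    RunsLe swap (vals (code a ++ (code b ++ rest))) (vals (code b ++ (code a ++ rest)))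
      (6 * size a + 6 * size b + 6) := by
  have h₁ := runs_scan true false [] (code b ++ rest) (enc a) [] []
  have h₂ := runs_scan false true [] rest (enc b) (code a).reverse []
  have h₃ := runs_unload_left [] rest (code a).reverse (code b).reverse []
  have h₄ := runs_unload_right [] (code a ++ rest) (code b).reverse [] []
  simp only [put, if_true, List.append_nil, List.reverse_reverse, List.length_reverse,
    ← code.eq_1, ← size.eq_1, length_code, Bool.false_eq_true, if_false] at h₁ h₂ h₃ h₄
  exact (h₁.seq (h₂.seq ((h₃.le le_rfl).seq (h₄.le le_rfl)))).mono (by omega)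

theorem runs_pop (a : CodeSymbol) (m : List CodeSymbol) :
    RunsLe pop (vals (a :: m)) (vals m) 1 := by
  have e := Runs.move_cons .main [] (vals (a :: m)) a m rfl
  rw [update_store_main] at e
  exact e.le le_rfl

theorem runs_push (a : CodeSymbol) (m : List CodeSymbol) :
    RunsLe (.push .main a) (vals m) (vals (a :: m)) 1 := by
  have e := Runs.push .main a (vals m)
  rw [update_store_main] at e
  exact e.le le_rfl

/-- Push a word on the main stack. -/
def pushWord : List CodeSymbol → Cmd
  | [] => .skip
  | a :: w => .seq (pushWord w) (.push .main a)

theorem runs_pushWord (i w m : List CodeSymbol) :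
    Runs (pushWord w) (store i m [] [] []) (store i (w ++ m) [] [] []) (w.length + 1) := by
  induction w with
  | nil => exact Runs.skip _
  | cons a w ih =>
    have e := Runs.push .main a (store i (w ++ m) [] [] [])
    rw [update_store_main] at e
    exact ih.seq e

/-! ### The class of polynomial-time functions -/

variable {α β γ δ X : Type} [Enc α] [Enc β] [Enc γ] [Enc δ] [Enc X]

/-- Boundedness by a polynomial in the size of the argument. -/
def PolyBdd (g : α → ℕ) : Prop := ∃ p : Polynomial ℕ, ∀ a, g a ≤ p.eval (size a)

theorem eval_mono (p : Polynomial ℕ) {m n : ℕ} (h : m ≤ n) : p.eval m ≤ p.eval n := by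
  induction p using Polynomial.induction_on' with
  | add p q hp hq => simp only [Polynomial.eval_add]; omega
  | monomial k a => simp only [Polynomial.eval_monomial]; gcongr

theorem PolyBdd.mono {g g' : α → ℕ} (h : PolyBdd g') (hg : ∀ a, g a ≤ g' a) : PolyBdd g :=
  let ⟨p, hp⟩ := h; ⟨p, fun a => (hg a).trans (hp a)⟩

theorem PolyBdd.const (n : ℕ) : PolyBdd (fun _ : α => n) :=
  ⟨Polynomial.C n, fun a => by simp⟩

theorem PolyBdd.arg : PolyBdd (fun a : α => size a) := ⟨Polynomial.X, fun a => by simp⟩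

theorem PolyBdd.add {g g' : α → ℕ} (h : PolyBdd g) (h' : PolyBdd g') :
    PolyBdd fun a => g a + g' a :=
  let ⟨p, hp⟩ := h; let ⟨q, hq⟩ := h'
  ⟨p + q, fun a => by rw [Polynomial.eval_add]; exact add_le_add (hp a) (hq a)⟩

theorem PolyBdd.mul {g g' : α → ℕ} (h : PolyBdd g) (h' : PolyBdd g') :
    PolyBdd fun a => g a * g' a :=
  let ⟨p, hp⟩ := h; let ⟨q, hq⟩ := h'
  ⟨p * q, fun a => by rw [Polynomial.eval_mul]; exact Nat.mul_le_mul (hp a) (hq a)⟩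

theorem PolyBdd.eval {g : α → ℕ} (h : PolyBdd g) (q : Polynomial ℕ) :
    PolyBdd fun a => q.eval (g a) :=
  let ⟨p, hp⟩ := h
  ⟨q.comp p, fun a => by rw [Polynomial.eval_comp]; exact eval_mono q (hp a)⟩

/-- A polynomial bound pulls back along a map that increases sizes polynomially. -/
theorem PolyBdd.comp {g : β → ℕ} (h : PolyBdd g) {f : α → β}
    (hf : PolyBdd fun a => size (f a)) : PolyBdd fun a => g (f a) :=
  let ⟨p, hp⟩ := h
  (hf.eval p).mono fun a => hp (f a)

/-- `f` is computed in polynomial time by a program that replaces the code of the argument, on top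
of the main stack, by the code of the value. -/
def PolyTime (f : α → β) : Prop :=
  ∃ (c : Cmd) (g : α → ℕ), PolyBdd g ∧
    ∀ a rest, RunsLe c (vals (code a ++ rest)) (vals (code (f a) ++ rest)) (g a)

theorem PolyTime.size_bdd {f : α → β} (hf : PolyTime f) : PolyBdd fun a => size (f a) := by
  obtain ⟨c, g, hg, h⟩ := hf
  refine (PolyBdd.arg.add ((PolyBdd.const c.width).mul hg)).mono fun a => ?_
  obtain ⟨m, hm, hr⟩ := h a []
  have := hr.length_le .main
  simp only [store_main, List.append_nil, length_code] at this
  exact this.trans (by gcongr)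

/-- Only codes matter: this transfers programs between types with coinciding encodings, such as
nonempty lists and pairs, or numbers and their numerals. -/
theorem PolyTime.of_enc_eq {f : α → β} {f' : α → γ} (hf : PolyTime f)
    (h : ∀ a, enc (f' a) = enc (f a)) : PolyTime f' := by
  obtain ⟨c, g, hg, hr⟩ := hf
  exact ⟨c, g, hg, fun a rest => by
    rw [show code (f' a) = code (f a) by rw [code, h, code]]; exact hr a rest⟩

theorem PolyTime.of_eq {f f' : α → β} (hf : PolyTime f) (h : ∀ a, f' a = f a) : PolyTime f' :=
  hf.of_enc_eq fun a => by rw [h]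

/-- A function that does not change the code. -/
theorem PolyTime.recode {f : α → β} (h : ∀ a, enc (f a) = enc a) : PolyTime f :=
  ⟨.skip, fun _ => 1, PolyBdd.const 1, fun a rest => by
    rw [show code (f a) = code a by rw [code, h, code]]; exact (Runs.skip _).le le_rfl⟩

theorem PolyTime.id : PolyTime fun a : α => a := PolyTime.recode fun _ => rfl

/-- The second running time is polynomial in the size of the intermediate value, which `size_bdd`
bounds in terms of the argument. -/
theorem PolyTime.comp {g : β → γ} {f : α → β} (hg : PolyTime g) (hf : PolyTime f) :
    PolyTime fun a => g (f a) := by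
  have hs := hf.size_bdd
  obtain ⟨c, p, hp, hr⟩ := hf
  obtain ⟨d, q, hq, hr'⟩ := hg
  exact ⟨.seq c d, fun a => p a + q (f a), hp.add (hq.comp hs),
    fun a rest => (hr a rest).seq (hr' _ rest)⟩

theorem PolyTime.const (b : β) : PolyTime fun _ : α => b := by
  refine ⟨.seq drop (pushWord (code b)), fun a => 4 * size a + 2 + ((code b).length + 1),
    (((PolyBdd.const 4).mul PolyBdd.arg).add (PolyBdd.const 2)).add (PolyBdd.const _), ?_⟩
  intro a rest
  exact (runs_drop _ _).seq ((runs_pushWord _ _ _).le le_rfl)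

instance : Enc Unit := ⟨fun _ => .leaf⟩

instance : Enc Bool := ⟨fun b => if b then .node .leaf .leaf else .leaf⟩

instance : Enc (α × β) := ⟨fun p => .node (enc p.1) (enc p.2)⟩

/-- The encoding of lists. -/
def encList : List α → Tree
  | [] => .leaf
  | a :: l => .node (enc a) (encList l)

instance : Enc (List α) := ⟨encList⟩

instance : Enc (Option α) := ⟨fun o => enc o.toList⟩

@[simp] theorem size_prod (p : α × β) : size p = size p.1 + size p.2 + 1 := rfl
@[simp] theorem size_nil : size ([] : List α) = 1 := rfl
@[simp] theorem size_cons (a : α) (l : List α) : size (a :: l) = size a + size l + 1 := rfl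

theorem code_prod (p : α × β) : code p = .one :: (code p.1 ++ code p.2) := rfl
theorem code_cons (a : α) (l : List α) : code (a :: l) = .one :: (code a ++ code l) := rfl

/-- A copy of the argument waits beneath the computation of `f a`, and then `f a` beneath that of `g
a`; the arbitrary `rest` in `PolyTime` permits this. -/
theorem PolyTime.pair {f : α → β} {g : α → γ} (hf : PolyTime f) (hg : PolyTime g) :
    PolyTime fun a => (f a, g a) := by
  have hs := hf.size_bdd
  have hs' := hg.size_bdd
  obtain ⟨c, p, hp, hr⟩ := hf
  obtain ⟨d, q, hq, hr'⟩ := hg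
  refine ⟨.seq dup (.seq c (.seq swap (.seq d (.seq swap (.push .main .one))))), fun a =>
    (8 * size a + 4) + (p a + ((6 * size (f a) + 6 * size a + 6)
      + (q a + ((6 * size (g a) + 6 * size (f a) + 6) + 1)))), ?_, ?_⟩
  · have c := fun n => PolyBdd.const (α := α) n
    exact (((c 8).mul .arg).add (c 4)).add (hp.add (((((c 6).mul hs).add ((c 6).mul .arg)).add
      (c 6)).add (hq.add (((((c 6).mul hs').add ((c 6).mul hs)).add (c 6)).add (c 1)))))
  · intro a rest
    refine (runs_dup _ _).seq ((hr a _).seq ((runs_swap _ _ _).seq ((hr' a _).seq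
      ((runs_swap _ _ _).seq ?_))))
    rw [code_prod, List.cons_append, List.append_assoc]
    exact runs_push _ _

theorem PolyTime.fst : PolyTime (Prod.fst : α × β → α) := by
  refine ⟨.seq pop (.seq swap drop), fun p => 1 +
    ((6 * size p + 6 * size p + 6) + (4 * size p + 2)), ?_, ?_⟩
  · have c := fun n => PolyBdd.const (α := α × β) n
    exact (c 1).add (((((c 6).mul .arg).add ((c 6).mul .arg)).add (c 6)).add
      (((c 4).mul .arg).add (c 2)))
  · rintro ⟨a, b⟩ rest
    rw [code_prod, List.cons_append, List.append_assoc]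
    refine ((runs_pop _ _).seq ((runs_swap _ _ _).seq (runs_drop _ _))).mono ?_
    simp only [size_prod]
    omega

theorem PolyTime.snd : PolyTime (Prod.snd : α × β → β) := by
  refine ⟨.seq pop drop, fun p => 1 + (4 * size p + 2), ?_, ?_⟩
  · have c := fun n => PolyBdd.const (α := α × β) n
    exact (c 1).add (((c 4).mul .arg).add (c 2))
  · rintro ⟨a, b⟩ rest
    rw [code_prod, List.cons_append, List.append_assoc]
    refine ((runs_pop _ _).seq (runs_drop _ _)).mono ?_
    simp only [size_prod]
    omega

theorem PolyTime.cons {f : α → β} {g : α → List β} (hf : PolyTime f) (hg : PolyTime g) :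
    PolyTime fun a => f a :: g a :=
  (hf.pair hg).of_enc_eq fun _ => rfl

/-- Case distinction on a list. -/
theorem PolyTime.list_cases {l : X → List α} {g : X → β} {h : X × α × List α → β} {f : X → β}
    (hl : PolyTime l) (hg : PolyTime g) (hh : PolyTime h) (hnil : ∀ x, l x = [] → f x = g x)
    (hcons : ∀ x a t, l x = a :: t → f x = h (x, a, t)) : PolyTime f := by
  have hls := hl.size_bdd
  obtain ⟨c, p, hp, hr⟩ := hl.pair PolyTime.id
  obtain ⟨d, q, hq, hrd⟩ := hg
  obtain ⟨e, r, hr', hre⟩ := hh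
  have hx : PolyBdd fun x : X => size x + size (l x) + 1 :=
    (PolyBdd.arg.add hls).add (.const 1)
  obtain ⟨p', hp'⟩ := hr'
  -- Without its node symbol, the pair `(l x, x)` begins with the code of `l x`, whose first symbol
  -- tells whether the list is empty. The code of `a :: t` is also that of the pair `(a, t)`.
  refine ⟨.seq c (.seq pop (.ite .main isOne (.seq swap (.seq (.push .main .one) e)) (.seq pop d))),
    fun x => p x + (1 + (((6 * size (l x) + 6 * size x + 6) +
      (1 + p'.eval (size x + size (l x) + 1))) + (1 + q x) + 1)), ?_, ?_⟩
  · have c := fun n => PolyBdd.const (α := X) n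
    exact hp.add ((c 1).add (((((((c 6).mul hls).add ((c 6).mul .arg)).add (c 6)).add
      ((c 1).add (hx.eval p'))).add ((c 1).add hq)).add (c 1)))
  · intro x rest
    have h₁ := hr x rest
    rw [code_prod, List.cons_append, List.append_assoc] at h₁
    refine h₁.seq ((runs_pop _ _).seq ?_)
    simp only
    cases hx : l x with
    | nil =>
      rw [hnil x hx]
      refine (RunsLe.ite_false (k := .main) (p := isOne) rfl
        ((runs_pop .zero _).seq (hrd x rest))).mono ?_
      omega
    | cons a t =>
      rw [hcons x a t hx]
      have h₂ := hre (x, a, t) rest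
      rw [code_prod, List.cons_append, List.append_assoc] at h₂
      refine (RunsLe.ite_true (k := .main) (p := isOne) rfl
        ((runs_swap (a, t) x _).seq ((runs_push _ _).seq h₂))).mono ?_
      have := hp' (x, a, t)
      simp only [size_prod, size_cons] at this ⊢
      rw [← add_assoc] at this
      simp only [← add_assoc] at this ⊢
      omega

/-- Case distinction on a Boolean value. -/
theorem PolyTime.bool_cases {b : X → Bool} {g h : X → β} {f : X → β}
    (hb : PolyTime b) (hg : PolyTime g) (hh : PolyTime h) (htrue : ∀ x, b x = true → f x = g x)
    (hfalse : ∀ x, b x = false → f x = h x) : PolyTime f := by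
  have hl : PolyTime fun x => if b x then [()] else [] := hb.of_enc_eq fun x => by
    cases b x <;> rfl
  refine PolyTime.list_cases hl hh (hg.comp .fst) (fun x hx => hfalse x ?_)
    (fun x a t hx => htrue x ?_)
  · cases h : b x <;> simp_all
  · cases h : b x <;> simp_all

theorem PolyTime.ite {c : X → Prop} [DecidablePred c] {g h : X → β}
    (hc : PolyTime fun x => decide (c x)) (hg : PolyTime g) (hh : PolyTime h) :
    PolyTime fun x => if c x then g x else h x :=
  PolyTime.bool_cases hc hg hh (fun x hx => if_pos (by simpa using hx))
    (fun x hx => if_neg (by simpa using hx))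

theorem length_le_size (l : List α) : l.length ≤ size l := by
  induction l with
  | nil => simp
  | cons a l ih => simp; omega

theorem size_le_of_suffix {l l' : List α} (h : l' <:+ l) : size l' ≤ size l := by
  obtain ⟨t, rfl⟩ := h
  induction t with
  | nil => exact le_rfl
  | cons a t ih => simp only [List.cons_append, size_cons] at *; omega

theorem size_append (l l' : List α) : size (l ++ l') + 1 = size l + size l' := by
  induction l with
  | nil => simp; omega
  | cons a t ih => simp only [List.cons_append, size_cons] at *; omega

/-- Iteration along a list, if the sizes of all intermediate results are bounded by a
polynomial. -/
theorem PolyTime.foldl {l : X → List α} {i : X → β} {h : X × β × α → β} {q : X → ℕ}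
    (hl : PolyTime l) (hi : PolyTime i) (hh : PolyTime h) (hq : PolyBdd q)
    (hb : ∀ x t, t <+: l x → size (t.foldl (fun b a => h (x, b, a)) (i x)) ≤ q x) :
    PolyTime fun x => (l x).foldl (fun b a => h (x, b, a)) (i x) := by
  let step : List α × β × X → List α × β × X := fun s =>
    match s.1 with
    | [] => s
    | a :: t => (t, h (s.2.2, s.2.1, a), s.2.2)
  have hstep : PolyTime step := by
    refine PolyTime.list_cases (l := Prod.fst) (g := fun s => s)
      (h := fun y : (List α × β × X) × α × List α => (y.2.2, h (y.1.2.2, y.1.2.1, y.2.1), y.1.2.2))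
      .fst .id ?_ ?_ ?_
    · have hx := (PolyTime.snd (α := β) (β := X)).comp
        ((PolyTime.snd (α := List α)).comp (PolyTime.fst (β := α × List α)))
      have hb := (PolyTime.fst (α := β) (β := X)).comp
        ((PolyTime.snd (α := List α)).comp (PolyTime.fst (β := α × List α)))
      exact (PolyTime.snd.comp .snd).pair
        ((hh.comp (hx.pair (hb.pair (PolyTime.fst.comp .snd)))).pair hx)
    · rintro ⟨l, b, x⟩ h; simp only at h; subst h; rfl
    · rintro ⟨l, b, x⟩ a t h; simp only at h; subst h; rfl
  obtain ⟨c, g, ⟨p, hp⟩, hr⟩ := hstep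
  obtain ⟨c₀, g₀, hg₀, hr₀⟩ := hl.pair (hi.pair PolyTime.id)
  obtain ⟨c₁, g₁, ⟨p₁, hp₁⟩, hr₁⟩ := PolyTime.fst (α := β) (β := X)
  -- The loop keeps the state without its outer node symbol, so that the test sees the first symbol
  -- of the remaining list. The body restores that symbol around each call of `c`, whose time is
  -- bounded by `T`.
  have key : ∀ (x : X) (T : ℕ) (rest : List CodeSymbol) (l : List α) (b : β),
      (∀ t u, l = t ++ u → g (u, t.foldl (fun b a => h (x, b, a)) b, x) ≤ T) →
      RunsLe (.loop .main isOne (.seq (.push .main .one) (.seq c pop)))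
        (vals (code l ++ (code (b, x) ++ rest)))
        (vals (.zero :: (code (l.foldl (fun b a => h (x, b, a)) b, x) ++ rest)))
        ((T + 3) * l.length + 1) := by
    intro x T rest l
    induction l with
    | nil => intro b _; exact (Runs.loop_exit rfl).le le_rfl
    | cons a l ih =>
      intro b hT
      have h₁ := hr (a :: l, b, x) rest
      rw [show step (a :: l, b, x) = (l, h (x, b, a), x) from rfl, code_prod, code_prod (l, _),
        List.cons_append, List.cons_append, List.append_assoc, List.append_assoc] at h₁
      have h₂ := ih (h (x, b, a)) fun t u htu => hT (a :: t) u (by simp [htu])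
      refine (RunsLe.loop_step (k := .main) (p := isOne) rfl
        ((runs_push _ _).seq (h₁.seq (runs_pop _ _))) h₂).mono ?_
      have := hT [] (a :: l) rfl
      simp only [List.foldl_nil, List.length_cons] at this ⊢
      nlinarith
  -- A common bound for the sizes of all states; the `2` accounts for the two pair nodes.
  have hs : PolyBdd fun x => size (l x) + q x + size x + 2 :=
    ((hl.size_bdd.add hq).add .arg).add (.const 2)
  refine ⟨.seq c₀ (.seq pop (.seq (.loop .main isOne (.seq (.push .main .one) (.seq c pop)))
    (.seq pop c₁))), fun x => g₀ x + (1 + (((p.eval (size (l x) + q x +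
      size x + 2) + 3) * size (l x) + 1) + (1 + p₁.eval (size (l x)
      + q x + size x + 2)))), ?_, ?_⟩
  · exact hg₀.add ((PolyBdd.const 1).add (((((hs.eval p).add (.const 3)).mul hl.size_bdd).add
      (.const 1)).add ((PolyBdd.const 1).add (hs.eval p₁))))
  · intro x rest
    have h₀ := hr₀ x rest
    rw [code_prod] at h₀
    simp only [List.cons_append, List.append_assoc] at h₀
    refine h₀.seq ((runs_pop _ _).seq (RunsLe.seq ?_ ((runs_pop .zero _).seq
       ((hr₁ (_, x) rest).mono ?_))))
    · refine (key x _ rest (l x) (i x) ?_).mono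
        (Nat.succ_le_succ (Nat.mul_le_mul_left _ (length_le_size _)))
      intro t u htu
      refine (hp _).trans (eval_mono p ?_)
      have h₁ := hb x t ⟨u, htu.symm⟩
      have h₂ : size u ≤ size (l x) := size_le_of_suffix ⟨t, htu.symm⟩
      simp only [size_prod]
      omega
    · refine (hp₁ _).trans (eval_mono p₁ ?_)
      have h₁ := hb x (l x) List.prefix_rfl
      simp only [size_prod]
      omega

end StackProgram

/-! ## Polynomial-time operations on lists -/

namespace StackProgram

open Enc (enc)

variable {α β γ X : Type} [Enc α] [Enc β] [Enc γ] [Enc X]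

attribute [fun_prop] PolyTime
attribute [fun_prop] PolyTime.id PolyTime.const PolyTime.comp PolyTime.pair PolyTime.fst
  PolyTime.snd PolyTime.cons PolyTime.ite

theorem size_pos (a : α) : 0 < size a := (enc a).size_pos

theorem size_bool_le (b : Bool) : size b ≤ 3 := by cases b <;> decide

theorem size_le_of_mem {a : α} {l : List α} (h : a ∈ l) : size a ≤ size l := by
  induction l with
  | nil => simp at h
  | cons b l ih =>
    rcases List.mem_cons.1 h with rfl | h
    · simp only [size_cons]; omega
    · have := ih h; simp only [size_cons]; omega

/-- Iteration along a list, if every step increases the size by a polynomially bounded amount. -/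
theorem PolyTime.foldl_of_le_add {l : X → List α} {i : X → β} {h : X → β → α → β} {q : X → ℕ}
    (hl : PolyTime l) (hi : PolyTime i) (hh : PolyTime fun p : X × β × α => h p.1 p.2.1 p.2.2)
    (hq : PolyBdd q) (hb : ∀ x b a, a ∈ l x → size (h x b a) ≤ size b + q x) :
    PolyTime fun x => (l x).foldl (h x) (i x) := by
  refine PolyTime.foldl (h := fun p : X × β × α => h p.1 p.2.1 p.2.2) hl hi hh
    (hi.size_bdd.add (hl.size_bdd.mul hq)) fun x t ht => ?_
  have key : ∀ (t : List α) (b : β), (∀ a ∈ t, a ∈ l x) →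
      size (t.foldl (h x) b) ≤ size b + t.length * q x := by
    intro t
    induction t with
    | nil => intro b _; simp
    | cons a t ih =>
      intro b ht
      have h₁ := ih (h x b a) fun c hc => ht c (List.mem_cons_of_mem _ hc)
      have h₂ := hb x b a (ht a List.mem_cons_self)
      simp only [List.foldl_cons, List.length_cons]
      nlinarith
  refine (key t (i x) fun a ha => ht.subset ha).trans ?_
  gcongr
  exact ht.length_le.trans (length_le_size _)

@[fun_prop]
theorem PolyTime.not {b : X → Bool} (hb : PolyTime b) : PolyTime fun x => !b x :=
  PolyTime.bool_cases hb (.const false) (.const true) (by simp_all) (by simp_all)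

@[fun_prop]
theorem PolyTime.and {b c : X → Bool} (hb : PolyTime b) (hc : PolyTime c) :
    PolyTime fun x => b x && c x :=
  PolyTime.bool_cases hb hc (.const false) (by simp_all) (by simp_all)

@[fun_prop]
theorem PolyTime.decide_eq_true {b : X → Bool} (hb : PolyTime b) :
    PolyTime fun x => decide (b x = true) :=
  hb.of_eq fun x => by simp

/-- Every function of a Boolean variable is computable in polynomial time. -/
theorem PolyTime.of_bool {b : X → Bool} (hb : PolyTime b) {f : Bool → X → β}
    (hf : ∀ c, PolyTime (f c)) : PolyTime fun x => f (b x) x :=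
  PolyTime.bool_cases hb (hf true) (hf false) (fun x h => by rw [h]) (fun x h => by rw [h])

@[fun_prop]
theorem PolyTime.tail {l : X → List α} (hl : PolyTime l) : PolyTime fun x => (l x).tail :=
  PolyTime.list_cases (h := fun p : X × α × List α => p.2.2) hl (.const []) (by fun_prop)
    (by simp_all) (by simp_all)

@[fun_prop]
theorem PolyTime.isEmpty {l : X → List α} (hl : PolyTime l) : PolyTime fun x => (l x).isEmpty :=
  PolyTime.list_cases (h := fun _ : X × α × List α => false) hl (.const true) (by fun_prop)
    (by simp_all) (by simp_all)

@[fun_prop]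
theorem PolyTime.headD {l : X → List α} {d : X → α} (hl : PolyTime l) (hd : PolyTime d) :
    PolyTime fun x => (l x).headD (d x) :=
  PolyTime.list_cases (h := fun p : X × α × List α => p.2.1) hl hd (by fun_prop)
    (by simp_all) (by simp_all)

@[fun_prop]
theorem PolyTime.reverse {l : X → List α} (hl : PolyTime l) : PolyTime fun x => (l x).reverse := by
  refine (PolyTime.foldl_of_le_add (h := fun _ (b : List α) a => a :: b) (i := fun _ => []) hl
    (by fun_prop) (by fun_prop) (hl.size_bdd.add (.const 1)) ?_).of_eq fun x => ?_
  · intro x b a ha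
    have := size_le_of_mem ha
    simp only [size_cons]
    omega
  · simp

@[fun_prop]
theorem PolyTime.append {l l' : X → List α} (hl : PolyTime l) (hl' : PolyTime l') :
    PolyTime fun x => l x ++ l' x := by
  refine (PolyTime.foldl_of_le_add (h := fun _ (b : List α) a => a :: b)
    (l := fun x => (l x).reverse) hl.reverse hl'
    (by fun_prop) (hl.size_bdd.add (.const 1)) ?_).of_eq fun x => ?_
  · intro x b a ha
    have := size_le_of_mem (List.mem_reverse.1 ha)
    simp only [size_cons]
    omega
  · simp

theorem size_bdd_of_mem {f : X → α → β} (hf : PolyTime fun p : X × α => f p.1 p.2)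
    {l : X → List α} (hl : PolyTime l) :
    ∃ q : X → ℕ, PolyBdd q ∧ ∀ x, ∀ a ∈ l x, size (f x a) ≤ q x := by
  obtain ⟨p, hp⟩ := hf.size_bdd
  refine ⟨fun x => p.eval (size x + size (l x) + 1),
    ((PolyBdd.arg.add hl.size_bdd).add (.const 1)).eval p, fun x a ha => ?_⟩
  refine (hp (x, a)).trans (eval_mono p ?_)
  have := size_le_of_mem ha
  simp only [size_prod]
  omega

@[fun_prop]
theorem PolyTime.map {l : X → List α} {f : X → α → β} (hl : PolyTime l)
    (hf : PolyTime fun p : X × α => f p.1 p.2) : PolyTime fun x => (l x).map (f x) := by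
  obtain ⟨q, hq, hb⟩ := size_bdd_of_mem hf hl
  have key : PolyTime fun x => (l x).foldl (fun b a => f x a :: b) [] := by
    refine PolyTime.foldl_of_le_add (h := fun x b a => f x a :: b) (q := fun x => q x + 1)
      hl (by fun_prop) ?_ (hq.add (.const 1)) fun x b a ha => ?_
    · have := hf.comp (f := fun p : X × List β × α => (p.1, p.2.2)) (by fun_prop)
      fun_prop
    · have := hb x a ha
      simp only [size_cons]
      omega
  refine key.reverse.of_eq fun x => ?_
  simp

@[fun_prop]
theorem PolyTime.flatMap {l : X → List α} {f : X → α → List β} (hl : PolyTime l)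
    (hf : PolyTime fun p : X × α => f p.1 p.2) : PolyTime fun x => (l x).flatMap (f x) := by
  obtain ⟨q, hq, hb⟩ := size_bdd_of_mem hf hl
  have key : PolyTime fun x => (l x).foldl (fun b a => b ++ f x a) [] := by
    refine PolyTime.foldl_of_le_add (h := fun x b a => b ++ f x a) (q := fun x => q x)
      hl (by fun_prop) ?_ hq fun x b a ha => ?_
    · have := hf.comp (f := fun p : X × List β × α => (p.1, p.2.2)) (by fun_prop)
      fun_prop
    · have := hb x a ha
      have := size_append b (f x a)
      omega
  refine key.of_eq fun x => ?_
  have : ∀ (t : List α) (b : List β), t.foldl (fun b a => b ++ f x a) b =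
      b ++ t.flatMap (f x) := by
    intro t
    induction t with
    | nil => simp
    | cons a t ih => intro b; simp [ih]
  simp [this]

@[fun_prop]
theorem PolyTime.filter {l : X → List α} {p : X → α → Bool} (hl : PolyTime l)
    (hp : PolyTime fun y : X × α => p y.1 y.2) : PolyTime fun x => (l x).filter (p x) := by
  refine (hl.flatMap (f := fun x a => if p x a then [a] else []) ?_).of_eq fun x => ?_
  · fun_prop
  · induction l x with
    | nil => rfl
    | cons a t ih => by_cases h : p x a <;> simp [h, ih]

@[fun_prop]
theorem PolyTime.any {l : X → List α} {p : X → α → Bool} (hl : PolyTime l)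
    (hp : PolyTime fun y : X × α => p y.1 y.2) : PolyTime fun x => (l x).any (p x) := by
  refine (hl.filter hp).isEmpty.not.of_eq fun x => ?_
  induction l x with
  | nil => rfl
  | cons a t ih => by_cases h : p x a <;> simp [h, ih]

@[fun_prop]
theorem PolyTime.all {l : X → List α} {p : X → α → Bool} (hl : PolyTime l)
    (hp : PolyTime fun y : X × α => p y.1 y.2) : PolyTime fun x => (l x).all (p x) := by
  refine (hl.any (p := fun x a => !p x a) hp.not).not.of_eq fun x => ?_
  rw [Bool.eq_iff_iff]
  simp

theorem size_filter_le (p : α → Bool) (l : List α) : size (l.filter p) ≤ size l := by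
  induction l with
  | nil => simp
  | cons a t ih => by_cases h : p a <;> simp [h] <;> omega

theorem enc_map_congr {α β γ : Type} [Enc β] [Enc γ] {f : α → β} {g : α → γ}
    (h : ∀ a, enc (f a) = enc (g a)) (l : List α) : enc (l.map f) = enc (l.map g) := by
  induction l with
  | nil => rfl
  | cons a t ih =>
    change Tree.node (enc (f a)) (enc (t.map f)) = Tree.node (enc (g a)) (enc (t.map g))
    rw [h, ih]

/-! ### Equality tests -/

/-- Types with an equality test in polynomial time. -/
class PolyEq (α : Type) [Enc α] [DecidableEq α] : Prop where
  polyTime_eq : PolyTime fun p : α × α => decide (p.1 = p.2)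

@[fun_prop]
theorem PolyTime.decide_eq [DecidableEq α] [PolyEq α] {f g : X → α} (hf : PolyTime f)
    (hg : PolyTime g) : PolyTime fun x => decide (f x = g x) :=
  PolyEq.polyTime_eq.comp (hf.pair hg)

theorem PolyEq.of_recode [DecidableEq α] [DecidableEq β] [PolyEq β] (f : α → β)
    (hf : Function.Injective f) (h : ∀ a, enc (f a) = enc a) : PolyEq α := by
  have hf' : PolyTime f := .recode h
  refine ⟨PolyTime.of_eq (f := fun p : α × α => decide (f p.1 = f p.2)) ?_ fun p => ?_⟩
  · fun_prop
  · simp [hf.eq_iff]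

instance : PolyEq Unit := ⟨(PolyTime.const true).of_eq fun _ => by simp⟩

instance : PolyEq Bool := ⟨by
  refine PolyTime.of_eq (f := fun p : Bool × Bool => if p.1 = true then p.2 else !p.2) ?_ ?_
  · fun_prop
  · decide⟩

/-- One step in the comparison of two lists. -/
def compareStep {α : Type} [DecidableEq α] (s : Bool × List α) (a : α) : Bool × List α :=
  if s.2.isEmpty then (false, []) else (s.1 && decide (s.2.headD a = a), s.2.tail)

/-- The flag records agreement so far and stays false once `r` has run out too early; a rest of `r`
is caught by the final emptiness test. -/
theorem foldl_compareStep {α : Type} [DecidableEq α] (l r : List α) (ok : Bool) :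
    (let s := l.foldl compareStep (ok, r); s.1 && s.2.isEmpty) = (ok && decide (l = r)) := by
  induction l generalizing r ok with
  | nil => cases r <;> simp
  | cons a l ih =>
    rw [List.foldl_cons, compareStep]
    cases r with
    | nil =>
      refine (ih [] false).trans ?_
      simp
    | cons b r =>
      refine (ih r _).trans ?_
      simp [Bool.and_assoc, eq_comm]

instance [DecidableEq α] [PolyEq α] : PolyEq (List α) := ⟨by
  have key : PolyTime fun p : List α × List α => p.1.foldl compareStep (true, p.2) := by
    refine PolyTime.foldl_of_le_add (h := fun _ s a => compareStep s a) (q := fun _ => 6)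
      (by fun_prop) (by fun_prop) ?_ (.const 6) fun x b a _ => ?_
    · unfold compareStep
      fun_prop
    · unfold compareStep
      have h₁ := size_bool_le
      split_ifs
      · simp only [size_prod, size_nil]
        have := h₁ false
        omega
      · simp only [size_prod]
        have := h₁ (b.1 && decide (b.2.headD a = a))
        have := size_le_of_suffix (List.tail_suffix b.2)
        omega
  refine PolyTime.of_eq (f := fun p : List α × List α =>
    let s := p.1.foldl compareStep (true, p.2); s.1 && s.2.isEmpty) ?_ fun p => ?_
  · exact (PolyTime.fst.comp key).and (PolyTime.snd.comp key).isEmpty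
  · rw [foldl_compareStep]; simp⟩

@[fun_prop]
theorem PolyTime.contains [DecidableEq α] [PolyEq α] {l : X → List α} {f : X → α}
    (hl : PolyTime l) (hf : PolyTime f) : PolyTime fun x => decide (f x ∈ l x) := by
  refine (hl.any (p := fun x a => decide (a = f x)) (by fun_prop)).of_eq fun x => ?_
  rw [Bool.eq_iff_iff]
  simp

/-- The first element of a list that satisfies a condition. -/
@[fun_prop]
theorem PolyTime.find {l : X → List α} {p : X → α → Bool} {d : X → α} (hl : PolyTime l)
    (hp : PolyTime fun y : X × α => p y.1 y.2) (hd : PolyTime d) :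
    PolyTime fun x => ((l x).find? (p x)).getD (d x) := by
  refine ((hl.filter hp).headD hd).of_eq fun x => ?_
  rw [← List.head?_filter, List.headD_eq_head?_getD]

end StackProgram

/-! ## Symbols and natural numbers -/

namespace StackProgram

open Enc (enc)

variable {α β γ X : Type} [Enc α] [Enc β] [Enc γ] [Enc X]

/-- The position of a symbol in the alphabet. -/
def symbolIndex : CodeSymbol → ℕ
  | .zero => 0
  | .one => 1
  | .comma => 2
  | .semicolon => 3
  | .bar => 4
  | .empty => 5

/-- The unary notation of a symbol. -/
def symbolWord (a : CodeSymbol) : List Unit := List.replicate (symbolIndex a) ()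

theorem symbolWord_injective : Function.Injective symbolWord := by
  intro a b
  cases a <;> cases b <;> simp [symbolWord, symbolIndex]

instance : Enc CodeSymbol := ⟨fun a => enc (symbolWord a)⟩

instance : PolyEq CodeSymbol := PolyEq.of_recode symbolWord symbolWord_injective fun _ => rfl

theorem size_symbol_le (a : CodeSymbol) : size a ≤ 11 := by cases a <;> decide

instance : Enc ℕ := ⟨fun n => enc (codeNat n)⟩

theorem codeNat_injective : Function.Injective codeNat := by
  intro m n h
  have : Function.Injective fun b : Bool => if b then CodeSymbol.one else CodeSymbol.zero := by
    intro a b; cases a <;> cases b <;> simp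
  have := congrArg Computability.decodeNat (this.list_map h)
  simpa using this

instance : PolyEq ℕ := PolyEq.of_recode codeNat codeNat_injective fun _ => rfl

@[fun_prop]
theorem PolyTime.codeNat {f : X → ℕ} (hf : PolyTime f) : PolyTime fun x => codeNat (f x) :=
  hf.of_enc_eq fun _ => rfl

/-! ### Binary arithmetic -/

/-- The bits of a natural number, least significant bit first. -/
abbrev bits (n : ℕ) : List Bool := Computability.encodeNat n

@[fun_prop]
theorem PolyTime.bits {f : X → ℕ} (hf : PolyTime f) : PolyTime fun x => bits (f x) := by
  refine (hf.codeNat.map (f := fun _ a => decide (a = CodeSymbol.one))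
    (by fun_prop)).of_eq fun x => ?_
  simp only [_root_.codeNat, List.map_map]
  conv_lhs => rw [← List.map_id (StackProgram.bits (f x))]
  refine List.map_congr_left fun b _ => ?_
  cases b <;> rfl

/-- The number with the given bits. -/
def ofBits (l : List Bool) : ℕ := l.foldr (fun b n => b.toNat + 2 * n) 0

@[simp] theorem ofBits_nil : ofBits [] = 0 := rfl
@[simp] theorem ofBits_cons (b : Bool) (l : List Bool) : ofBits (b :: l) = b.toNat + 2 * ofBits l :=
  rfl

theorem ofBits_append (l r : List Bool) :
    ofBits (l ++ r) = ofBits l + 2 ^ l.length * ofBits r := by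
  induction l with
  | nil => simp
  | cons b l ih => simp [ih, pow_succ]; ring

/-- Zero must be excluded because its numeral is empty and not a single zero bit. -/
theorem bits_bit (b : Bool) (n : ℕ) (h : b.toNat + 2 * n ≠ 0) :
    bits (b.toNat + 2 * n) = b :: bits n := by
  have e : b.toNat + 2 * n = Nat.bit b n := by cases b <;> simp [Nat.bit]; omega
  rw [e] at h ⊢
  unfold bits Computability.encodeNat
  rw [← Num.ofNat'_eq, ← Num.ofNat'_eq, Num.ofNat'_bit]
  cases hn : Num.ofNat' n with
  | zero =>
    have : n = 0 := by
      have := congrArg (fun m : Num => (m : ℕ)) hn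
      rw [Num.ofNat'_eq] at this
      simpa using this
    subst this
    cases b
    · simp at h
    · rfl
  | pos p => cases b <;> rfl

@[simp] theorem bits_zero : bits 0 = [] := rfl

theorem ofBits_bits (n : ℕ) : ofBits (bits n) = n := by
  induction n using Nat.strong_induction_on with
  | _ n ih =>
    rcases Nat.eq_zero_or_pos n with rfl | hn
    · rfl
    · have e : n = (decide (n % 2 = 1)).toNat + 2 * (n / 2) := by
        rcases Nat.mod_two_eq_zero_or_one n with h | h <;> simp [h] <;> omega
      have h := bits_bit (decide (n % 2 = 1)) (n / 2) (by omega)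
      rw [← e] at h
      rw [h, ofBits_cons, ih _ (by omega), ← e]

/-- Remove the zeros at the most significant end. -/
theorem bits_ofBits (l : List Bool) :
    bits (ofBits l) = l.foldr (fun b t => if (!b && t.isEmpty) = true then [] else b :: t) [] := by
  induction l with
  | nil => rfl
  | cons b l ih =>
    rw [List.foldr_cons, ← ih, ofBits_cons]
    by_cases h : b.toNat + 2 * ofBits l = 0
    · have h₁ : b = false := by cases b <;> simp_all
      have h₂ : ofBits l = 0 := by omega
      simp [h₁, h₂]
    · rw [bits_bit _ _ h, if_neg]
      intro h'
      simp only [Bool.and_eq_true, Bool.not_eq_true', List.isEmpty_iff] at h'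
      have := congrArg ofBits h'.2
      rw [ofBits_bits] at this
      simp [h'.1, this] at h

theorem enc_ofBits (n : ℕ) :
    enc n = enc ((bits n).map fun b => if b = true then CodeSymbol.one else CodeSymbol.zero) := rfl

@[fun_prop]
theorem PolyTime.ofBits {f : X → List Bool} (hf : PolyTime f) : PolyTime fun x => ofBits (f x) := by
  have key : PolyTime fun x => (f x).reverse.foldl
      (fun t b => if (!b && t.isEmpty) = true then [] else b :: t) [] := by
    refine PolyTime.foldl_of_le_add (q := fun _ => 4)
      (h := fun _ (t : List Bool) b => if (!b && t.isEmpty) = true then [] else b :: t)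
      (by fun_prop) (by fun_prop) (by fun_prop) (.const 4) fun x b a _ => ?_
    have := size_bool_le a
    split_ifs
    · simp only [size_nil]; omega
    · simp only [size_cons]; omega
  refine (key.map (f := fun _ b => if b = true then CodeSymbol.one else CodeSymbol.zero)
    (by fun_prop)).of_enc_eq fun x => ?_
  rw [enc_ofBits, bits_ofBits, List.foldl_reverse]

/-- One step of a serial device that combines two numbers bit by bit; the state consists of the
carry, the remaining bits of the second number, and the bits of the result in reverse order. -/
def serialStep (F : Bool → Bool → Bool → Bool × Bool) (s : Bool × List Bool × List Bool)
    (a : Bool) : Bool × List Bool × List Bool :=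
  ((F a (s.2.1.headD false) s.1).2, s.2.1.tail, (F a (s.2.1.headD false) s.1).1 :: s.2.2)

/-- Run the serial device on two numbers. -/
def serial (F : Bool → Bool → Bool → Bool × Bool) (m n : ℕ) : Bool × List Bool × List Bool :=
  -- The padding makes the first operand at least as long as the second, so that the second is read
  -- completely.
  (bits m ++ (bits n).map fun _ => false).foldl (serialStep F) (false, bits n, [])

theorem PolyTime.serial (F : Bool → Bool → Bool → Bool × Bool) {f g : X → ℕ} (hf : PolyTime f)
    (hg : PolyTime g) : PolyTime fun x => serial F (f x) (g x) := by
  have hF : ∀ {Y : Type} [Enc Y] {a b c : Y → Bool}, PolyTime a → PolyTime b → PolyTime c →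
      PolyTime fun y => F (a y) (b y) (c y) := fun {Y} _ {a b c} ha hb hc =>
    PolyTime.of_bool ha (f := fun a y => F a (b y) (c y)) fun a =>
      PolyTime.of_bool hb (f := fun b y => F a b (c y)) fun b =>
        PolyTime.of_bool hc (f := fun c _ => F a b c) fun c => .const _
  -- The `6`: a carry of size at most 3 replaces one of size at least 1, and a new output bit costs
  -- at most 3 + 1.
  refine PolyTime.foldl_of_le_add (h := fun _ s a => serialStep F s a) (q := fun _ => 6)
    (by fun_prop) (by fun_prop) ?_ (.const 6) fun x s a _ => ?_
  · unfold serialStep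
    have := hF (a := fun p : X × (Bool × List Bool × List Bool) × Bool => p.2.2)
      (b := fun p => p.2.1.2.1.headD false) (c := fun p => p.2.1.1) (by fun_prop) (by fun_prop)
      (by fun_prop)
    fun_prop
  · have h₁ := size_bool_le (F a (s.2.1.headD false) s.1).1
    have h₂ := size_bool_le (F a (s.2.1.headD false) s.1).2
    have h₃ := size_le_of_suffix (List.tail_suffix s.2.1)
    have := size_pos s.1
    simp only [serialStep, size_prod, size_cons]
    omega

theorem ofBits_head_tail (l : List Bool) :
    ofBits l = (l.headD false).toNat + 2 * ofBits l.tail := by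
  cases l <;> simp

theorem ofBits_replicate_false (l : List Bool) (l' : List Bool) :
    ofBits (l ++ l'.map fun _ => false) = ofBits l := by
  rw [ofBits_append]
  suffices ofBits (l'.map fun _ => false) = 0 by rw [this]; simp
  induction l' with
  | nil => rfl
  | cons b l ih => rw [List.map_cons, ofBits_cons, ih]; rfl

/-- The sum and the carry of three bits. -/
def fullAdder (a b c : Bool) : Bool × Bool := ((a ^^ b) ^^ c, (a && b) || (c && (a || b)))

/-- The difference and the borrow of three bits. -/
def fullSubtractor (a b c : Bool) : Bool × Bool :=
  ((a ^^ b) ^^ c, (!a && (b || c)) || (b && c))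

theorem fullAdder_spec (a b c : Bool) : (fullAdder a b c).1.toNat + 2 * (fullAdder a b c).2.toNat =
    a.toNat + b.toNat + c.toNat := by
  cases a <;> cases b <;> cases c <;> rfl

theorem fullSubtractor_spec (a b c : Bool) :
    (fullSubtractor a b c).1.toNat + b.toNat + c.toNat =
      a.toNat + 2 * (fullSubtractor a b c).2.toNat := by
  cases a <;> cases b <;> cases c <;> rfl

/-- Invariant: the emitted bits, plus carry and unread operands at weight `2 ^ o.length`, keep their
total value. -/
theorem foldl_fullAdder (l : List Bool) (c : Bool) (r o : List Bool) (h : r.length ≤ l.length) :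
    let s := l.foldl (serialStep fullAdder) (c, r, o)
    ofBits (s.2.2.reverse ++ [s.1]) =
      ofBits o.reverse + 2 ^ o.length * (c.toNat + ofBits l + ofBits r) := by
  induction l generalizing c r o with
  | nil =>
    have : r = [] := by simpa using h
    subst this
    simp [ofBits_append]
  | cons a l ih =>
    rw [List.foldl_cons, serialStep]
    refine (ih _ _ _ (by simp at h ⊢; omega)).trans ?_
    simp only [List.reverse_cons, ofBits_append, List.length_reverse, List.length_cons, ofBits_cons,
      ofBits_nil]
    have := fullAdder_spec a (r.headD false) c
    rw [ofBits_head_tail r, pow_succ]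
    linear_combination 2 ^ o.length * this

/-- The same invariant with the borrow counted negatively; negative terms are moved to the other
side to stay in `ℕ`. -/
theorem foldl_fullSubtractor (l : List Bool) (c : Bool) (r o : List Bool)
    (h : r.length ≤ l.length) :
    let s := l.foldl (serialStep fullSubtractor) (c, r, o)
    ofBits s.2.2.reverse + 2 ^ o.length * (c.toNat + ofBits r) =
      ofBits o.reverse + 2 ^ o.length * ofBits l + 2 ^ s.2.2.length * s.1.toNat := by
  induction l generalizing c r o with
  | nil =>
    have : r = [] := by simpa using h
    subst this
    simp
  | cons a l ih =>
    rw [List.foldl_cons, serialStep]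
    have h₁ := ih (fullSubtractor a (r.headD false) c).2 r.tail
      ((fullSubtractor a (r.headD false) c).1 :: o) (by simp at h ⊢; omega)
    simp only [List.reverse_cons, ofBits_append, List.length_reverse, List.length_cons, ofBits_cons,
      ofBits_nil] at h₁ ⊢
    have := fullSubtractor_spec a (r.headD false) c
    rw [ofBits_head_tail r]
    rw [pow_succ 2 o.length] at h₁
    linear_combination h₁ + 2 ^ o.length * this

theorem add_eq_serial (m n : ℕ) : m + n =
    ofBits ((serial fullAdder m n).2.2.reverse ++ [(serial fullAdder m n).1]) := by
  refine Eq.symm ((foldl_fullAdder _ false _ [] (by simp)).trans ?_)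
  rw [ofBits_replicate_false, ofBits_bits, ofBits_bits]
  simp

theorem ofBits_lt (l : List Bool) : ofBits l < 2 ^ l.length := by
  induction l with
  | nil => simp
  | cons b l ih =>
    have := b.toNat_le
    simp only [ofBits_cons, List.length_cons, pow_succ]
    omega

/-- The emitted bits represent a number below 2 to their count, so a final borrow forces `m < n`,
where truncated subtraction gives zero. -/
theorem sub_eq_serial (m n : ℕ) : m - n =
    if (serial fullSubtractor m n).1 = true then 0
    else ofBits (serial fullSubtractor m n).2.2.reverse := by
  have h := foldl_fullSubtractor (bits m ++ (bits n).map fun _ => false) false (bits n) [] (by simp)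
  change ofBits (serial fullSubtractor m n).2.2.reverse + _ =
    _ + 2 ^ (serial fullSubtractor m n).2.2.length * (serial fullSubtractor m n).1.toNat at h
  simp only [List.length_nil, pow_zero, one_mul, ofBits_replicate_false, ofBits_bits,
    List.reverse_nil, ofBits_nil, Bool.toNat_false, zero_add] at h
  have hlt := ofBits_lt (serial fullSubtractor m n).2.2.reverse
  rw [List.length_reverse] at hlt
  split_ifs with hc
  · simp only [hc, Bool.toNat_true, mul_one] at h
    omega
  · rw [Bool.not_eq_true] at hc
    simp only [hc, Bool.toNat_false, mul_zero] at h
    omega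

@[fun_prop]
theorem PolyTime.nat_add {f g : X → ℕ} (hf : PolyTime f) (hg : PolyTime g) :
    PolyTime fun x => f x + g x := by
  have h := PolyTime.serial fullAdder hf hg
  refine PolyTime.of_eq (f := fun x => StackProgram.ofBits
    ((StackProgram.serial fullAdder (f x) (g x)).2.2.reverse ++
      [(StackProgram.serial fullAdder (f x) (g x)).1])) ?_ fun x => add_eq_serial _ _
  fun_prop

@[fun_prop]
theorem PolyTime.nat_sub {f g : X → ℕ} (hf : PolyTime f) (hg : PolyTime g) :
    PolyTime fun x => f x - g x := by
  have h := PolyTime.serial fullSubtractor hf hg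
  refine PolyTime.of_eq (f := fun x =>
    if (StackProgram.serial fullSubtractor (f x) (g x)).1 = true then 0 else StackProgram.ofBits
      (StackProgram.serial fullSubtractor (f x) (g x)).2.2.reverse) ?_
    fun x => sub_eq_serial _ _
  fun_prop

theorem length_bits_le {n k : ℕ} (h : n < 2 ^ k) : (bits n).length ≤ k := by
  induction k generalizing n with
  | zero => have : n = 0 := by omega
            subst this; simp
  | succ k ih =>
    rcases Nat.eq_zero_or_pos n with rfl | hn
    · simp
    · have e : n = (decide (n % 2 = 1)).toNat + 2 * (n / 2) := by
        rcases Nat.mod_two_eq_zero_or_one n with h | h <;> simp [h] <;> omega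
      have h₁ := bits_bit (decide (n % 2 = 1)) (n / 2) (by omega)
      rw [← e] at h₁
      rw [h₁, List.length_cons]
      have := ih (n := n / 2) (by rw [pow_succ] at h; omega)
      omega

theorem size_nat (n : ℕ) : size n = size (codeNat n) := rfl

theorem size_word_le (w : List CodeSymbol) : size w ≤ 12 * w.length + 1 := by
  induction w with
  | nil => simp
  | cons a l ih => have := size_symbol_le a; simp only [size_cons, List.length_cons]; omega

theorem size_le_of_lt_two_pow {n k : ℕ} (h : n < 2 ^ k) : size n ≤ 12 * k + 1 := by
  have h₁ := size_word_le (codeNat n)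
  have h₂ : (codeNat n).length = (bits n).length := List.length_map _
  have := length_bits_le h
  rw [size_nat]
  omega

theorem lt_two_pow_size (n : ℕ) : n < 2 ^ size n := by
  have h := ofBits_lt (bits n)
  rw [ofBits_bits] at h
  refine h.trans_le (Nat.pow_le_pow_right (by omega) ?_)
  have := length_le_size (codeNat n)
  rwa [codeNat, List.length_map] at this

theorem sum_lt_two_pow_size (l : List ℕ) : l.sum < 2 ^ size l := by
  induction l with
  | nil => simp
  | cons a l ih =>
    have h₁ := lt_two_pow_size a
    simp only [List.sum_cons, size_cons]
    have h₂ : 1 ≤ 2 ^ size a := Nat.one_le_two_pow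
    have h₃ : 1 ≤ 2 ^ size l := Nat.one_le_two_pow
    rw [pow_succ, pow_add]
    nlinarith

-- Partial sums never exceed the full sum, which is below `2 ^ size (l x)`, so their numerals stay
-- of linear size.
@[fun_prop]
theorem PolyTime.sum {l : X → List ℕ} (hl : PolyTime l) : PolyTime fun x => (l x).sum := by
  refine (PolyTime.foldl (h := fun p : X × ℕ × ℕ => p.2.1 + p.2.2) (i := fun _ => 0)
    (q := fun x => 12 * size (l x) + 1) hl (by fun_prop) (by fun_prop)
    (((PolyBdd.const 12).mul hl.size_bdd).add (.const 1)) fun x t ht => ?_).of_eq fun x => ?_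
  · refine size_le_of_lt_two_pow ?_
    rw [← List.sum_eq_foldl]
    obtain ⟨u, hu⟩ := ht
    refine lt_of_le_of_lt ?_ (sum_lt_two_pow_size (l x))
    rw [← hu, List.sum_append]
    omega
  · exact List.sum_eq_foldl

end StackProgram

/-! ## The algorithm and its running time -/

namespace NextLabel

open StackProgram
open StackProgram.Enc (enc)

variable {α X : Type} [Enc α] [Enc X]

/-- An edge, given by its source, its target and its label. -/
abbrev Edge := ℕ × ℕ × Option ℕ

/-- A list of edges, a list whose length is the length of the walks that are counted, and the start
and the terminal vertex of the walks. -/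
abbrev Net := List Edge × List Unit × ℕ × ℕ

/-- The label of the edge, if there is one, belongs to `W`. -/
def allowed (W : List ℕ) (e : Edge) : Bool := e.2.2.toList.all fun u => decide (u ∈ W)

/-- The sum of all entries with key `v` of a table. -/
def lookup (T : List (ℕ × ℕ)) (v : ℕ) : ℕ :=
  ((T.filter fun p => decide (p.1 = v)).map Prod.snd).sum

/-- Turn a table that counts the walks of some length from each vertex into the table for the walks
that have one edge more. -/
def walkStep (E : List Edge) (W : List ℕ) (T : List (ℕ × ℕ)) : List (ℕ × ℕ) :=
  (E.filter (allowed W)).map fun e => (e.1, lookup T e.2.1)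

/-- The number of walks with all labels in `W`. -/
def walkCount (D : Net) (W : List ℕ) : ℕ :=
  lookup (D.2.1.foldl (fun T _ => walkStep D.1 W T) [(D.2.2.2, 1)]) D.2.2.1

/-- Test for inclusion of the sets presented by two lists. -/
def subset (A B : List ℕ) : Bool := A.all fun u => decide (u ∈ B)

/-- A list that presents every set of a family once. -/
def distinct (S : List (List ℕ)) : List (List ℕ) :=
  S.foldl (fun T A => if (T.any fun B => subset A B && subset B A) = true then T else A :: T) []

/-- Improve a table of the numbers of walks with a given set of labels. -/
def refineTable (D : Net) (S : List (List ℕ)) (T : List (List ℕ × ℕ)) : List (List ℕ × ℕ) :=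
  -- Subtraction is truncated: an entry may be wrong if some set is missing below `A`, but it never
  -- exceeds `walkCount D A`.
  S.map fun A => (A, walkCount D A -
    ((T.filter fun p => subset p.1 A && !subset A p.1).map Prod.snd).sum)

/-- The table of the numbers of walks whose set of labels is a given set of the family. -/
def exactTable (D : Net) (S : List (List ℕ)) (U : List ℕ) : List (List ℕ × ℕ) :=
  -- The dummy `0` provides an extra round: the first round settles the empty set, and each later
  -- one the next cardinality.
  (0 :: U).foldl (fun T _ => refineTable D S T) []

/-- The walks with labels in `W` are not all accounted for by the table. -/
def deficient (D : Net) (T : List (List ℕ × ℕ)) (W : List ℕ) : Bool :=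
  !decide (walkCount D W = ((T.filter fun p => subset p.1 W).map Prod.snd).sum)

/-- The lists that arise by deleting one element. -/
def deletions (A : List ℕ) : List (List ℕ) := A.map fun u => A.filter fun v => !decide (v = u)

/-- The sets among which a smaller deficient set is searched. -/
def candidates (S : List (List ℕ)) (W : List ℕ) : List (List ℕ) :=
  -- Deletions from `W` make the final set itself the missing one; deletions from members of `S`
  -- certify the table entries below it.
  ((W :: S).filter fun A => subset A W).flatMap deletions

/-- Replace a set by a smaller deficient set, if possible. -/
def descend (D : Net) (S : List (List ℕ)) (T : List (List ℕ × ℕ)) (W : List ℕ) : List ℕ :=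
  ((candidates S W).find? (deficient D T)).getD W

/-- The set that is reached by repeated descent from `U`. -/
def descent (D : Net) (S : List (List ℕ)) (T : List (List ℕ × ℕ)) (U : List ℕ) : List ℕ :=
  U.foldl (fun W _ => descend D S T W) U

/-- All labels of the edges. -/
def labels (E : List Edge) : List ℕ := E.flatMap fun e => e.2.2.toList

/-- The answer for a family without repetitions, given the table of exact numbers. -/
def answerOfTable (D : Net) (S : List (List ℕ)) (T : List (List ℕ × ℕ)) : Option (List ℕ) :=
  if deficient D T (descent D S T (labels D.1)) = true then some (descent D S T (labels D.1))
  else none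

/-- The answer of the algorithm. -/
def answer (D : Net) (S : List (List ℕ)) : Option (List ℕ) :=
  answerOfTable D (distinct S) (exactTable D (distinct S) (labels D.1))

/-! ### Running time of the ingredients -/

theorem _root_.StackProgram.PolyTime.toList {o : X → Option α} (ho : PolyTime o) :
    PolyTime fun x => (o x).toList := ho.of_enc_eq fun _ => rfl

attribute [fun_prop] PolyTime.toList

@[fun_prop]
theorem polyTime_allowed {W : X → List ℕ} {e : X → Edge} (hW : PolyTime W) (he : PolyTime e) :
    PolyTime fun x => allowed (W x) (e x) := by
  unfold allowed
  fun_prop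

@[fun_prop]
theorem polyTime_lookup {T : X → List (ℕ × ℕ)} {v : X → ℕ} (hT : PolyTime T) (hv : PolyTime v) :
    PolyTime fun x => lookup (T x) (v x) := by
  unfold lookup
  fun_prop

@[fun_prop]
theorem polyTime_walkStep {E : X → List Edge} {W : X → List ℕ} {T : X → List (ℕ × ℕ)}
    (hE : PolyTime E) (hW : PolyTime W) (hT : PolyTime T) :
    PolyTime fun x => walkStep (E x) (W x) (T x) := by
  unfold walkStep
  fun_prop

/-- The sum of all entries of a table. -/
def total (T : List (ℕ × ℕ)) : ℕ := (T.map Prod.snd).sum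

theorem sum_filter_map_le {α : Type} (p : α → Bool) (f : α → ℕ) (l : List α) :
    ((l.filter p).map f).sum ≤ (l.map f).sum := by
  induction l with
  | nil => simp
  | cons a l ih => by_cases h : p a <;> simp [h] <;> omega

theorem lookup_le_total (T : List (ℕ × ℕ)) (v : ℕ) : lookup T v ≤ total T :=
  sum_filter_map_le _ _ _

/-- Each allowed edge contributes one entry, which is at most the previous total. -/
theorem total_walkStep_le (E : List Edge) (W : List ℕ) (T : List (ℕ × ℕ)) :
    total (walkStep E W T) ≤ E.length * total T := by
  unfold total walkStep
  rw [List.map_map]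
  refine (sum_filter_map_le _ _ _).trans ?_
  refine (List.sum_le_card_nsmul _ (total T) fun n hn => ?_).trans ?_
  · obtain ⟨e, _, rfl⟩ := List.mem_map.1 hn
    exact lookup_le_total _ _
  · simp [total]

/-- Each step multiplies the total by at most `E.length ≤ 2 ^ E.length`, so walk numbers have
polynomially many bits. -/
theorem total_foldl_walkStep_lt {β : Type} (E : List Edge) (W : List ℕ) (t : ℕ) (R : List β) :
    total (R.foldl (fun T _ => walkStep E W T) [(t, 1)]) < 2 ^ (E.length * R.length + 1) := by
  have key : ∀ (R : List β) (T : List (ℕ × ℕ)),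
      total (R.foldl (fun T _ => walkStep E W T) T) ≤ 2 ^ (E.length * R.length) * total T := by
    intro R
    induction R with
    | nil => intro T; simp
    | cons a R ih =>
      intro T
      rw [List.foldl_cons]
      have h₁ := ih (walkStep E W T)
      have h₂ := total_walkStep_le E W T
      have h₃ : E.length ≤ 2 ^ E.length := Nat.lt_two_pow_self.le
      calc _ ≤ 2 ^ (E.length * R.length) * (E.length * total T) := h₁.trans (by gcongr)
        _ ≤ 2 ^ (E.length * R.length) * (2 ^ E.length * total T) := by gcongr
        _ = _ := by rw [List.length_cons, Nat.mul_succ, pow_add]; ring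
  refine (key R _).trans_lt ?_
  simp [total, pow_succ]

theorem size_le_of_forall_mem {l : List α} {B : ℕ} (h : ∀ a ∈ l, size a ≤ B) :
    size l ≤ l.length * (B + 1) + 1 := by
  induction l with
  | nil => simp
  | cons a l ih =>
    have h₁ := h a List.mem_cons_self
    have h₂ := ih fun b hb => h b (List.mem_cons_of_mem _ hb)
    simp only [size_cons, List.length_cons]
    nlinarith

@[fun_prop]
theorem polyTime_walkCount {D : X → Net} {W : X → List ℕ} (hD : PolyTime D) (hW : PolyTime W) :
    PolyTime fun x => walkCount (D x) (W x) := by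
  unfold walkCount
  have hR : PolyTime fun x => (D x).2.1 := by fun_prop
  have hE : PolyTime fun x => (D x).1 := by fun_prop
  have ht : PolyTime fun x => (D x).2.2.2 := by fun_prop
  have key : PolyTime fun x => (D x).2.1.foldl (fun T _ => walkStep (D x).1 (W x) T)
      [((D x).2.2.2, 1)] := by
    -- After a step the table has at most one entry per edge: a source and a number of at most `|E|
    -- |R| + 1` bits, at size 12 per bit. The last summand covers the initial table.
    refine PolyTime.foldl (i := fun x => [((D x).2.2.2, 1)])
      (h := fun p : X × List (ℕ × ℕ) × Unit => walkStep (D p.1).1 (W p.1) p.2.1)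
      (q := fun x =>
        size (D x).1 * (size (D x).1 + (12 * (size (D x).1 * size (D x).2.1 + 1) + 1) + 1 + 1) + 1
        + (size (D x).2.2.2 + 20)) hR (by fun_prop) (by fun_prop) ?_ ?_
    · have c := fun n => PolyBdd.const (α := X) n
      exact ((hE.size_bdd.mul (((hE.size_bdd.add (((c 12).mul ((hE.size_bdd.mul hR.size_bdd).add
        (c 1))).add (c 1))).add (c 1)).add (c 1))).add (c 1)).add (ht.size_bdd.add (c 20))
    · intro x t hxt
      rcases List.eq_nil_or_concat t with rfl | ⟨r, a, rfl⟩
      · have : size 1 ≤ 12 * 1 + 1 := size_le_of_lt_two_pow (by norm_num)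
        simp only [List.foldl_nil, size_cons, size_prod, size_nil]
        omega
      · simp only [List.foldl_append, List.foldl_cons, List.foldl_nil, List.concat_eq_append]
        have hr : r.length ≤ size (D x).2.1 := by
          have := hxt.length_le
          have := length_le_size (D x).2.1
          simp at *
          omega
        have hEl := length_le_size (D x).1
        refine (size_le_of_forall_mem (B := size (D x).1 +
          (12 * (size (D x).1 * size (D x).2.1 + 1) + 1) + 1) ?_).trans ?_
        · intro p hp
          obtain ⟨e, he, rfl⟩ := List.mem_map.1 hp
          have h₁ := size_le_of_mem (List.mem_of_mem_filter he)
          have h₂ : size (lookup (r.foldl (fun T _ => walkStep (D x).1 (W x) T)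
              [((D x).2.2.2, 1)]) e.2.1) ≤ 12 * ((D x).1.length * r.length + 1) + 1 :=
            size_le_of_lt_two_pow ((lookup_le_total _ _).trans_lt (total_foldl_walkStep_lt _ _ _ _))
          have h₃ : (D x).1.length * r.length ≤ size (D x).1 * size (D x).2.1 :=
            Nat.mul_le_mul hEl hr
          simp only [size_prod] at h₁ ⊢
          omega
        · have : (walkStep (D x).1 (W x) (r.foldl (fun T _ => walkStep (D x).1 (W x) T)
              [((D x).2.2.2, 1)])).length ≤ size (D x).1 := by
            unfold walkStep
            rw [List.length_map]
            exact (List.length_filter_le _ _).trans hEl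
          refine le_trans ?_ (Nat.le_add_right _ _)
          gcongr
  exact polyTime_lookup key (by fun_prop)

@[fun_prop]
theorem polyTime_subset {A B : X → List ℕ} (hA : PolyTime A) (hB : PolyTime B) :
    PolyTime fun x => subset (A x) (B x) := by
  unfold subset
  fun_prop

@[fun_prop]
theorem polyTime_distinct {S : X → List (List ℕ)} (hS : PolyTime S) :
    PolyTime fun x => distinct (S x) := by
  refine PolyTime.foldl_of_le_add (h := fun _ T A =>
      if (T.any fun B => subset A B && subset B A) = true then T else A :: T)
    (q := fun x => size (S x) + 1) hS (by fun_prop) (by fun_prop) (hS.size_bdd.add (.const 1))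
    fun x T A hA => ?_
  have := size_le_of_mem hA
  split_ifs
  · omega
  · simp only [size_cons]; omega

@[fun_prop]
theorem polyTime_refineTable {D : X → Net} {S : X → List (List ℕ)} {T : X → List (List ℕ × ℕ)}
    (hD : PolyTime D) (hS : PolyTime S) (hT : PolyTime T) :
    PolyTime fun x => refineTable (D x) (S x) (T x) := by
  unfold refineTable
  fun_prop

-- Every round rebuilds the table from `S` with entries at most `walkCount`, so its size does not
-- grow with the number of rounds.
@[fun_prop]
theorem polyTime_exactTable {D : X → Net} {S : X → List (List ℕ)} {U : X → List ℕ}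
    (hD : PolyTime D) (hS : PolyTime S) (hU : PolyTime U) :
    PolyTime fun x => exactTable (D x) (S x) (U x) := by
  obtain ⟨q, hq, hb⟩ := size_bdd_of_mem (f := fun x A => walkCount (D x) A) (l := S)
    (by fun_prop) hS
  refine PolyTime.foldl
    (h := fun p : X × List (List ℕ × ℕ) × ℕ => refineTable (D p.1) (S p.1) p.2.1)
    (q := fun x => size (S x) * ((size (S x) + (12 * q x + 1) + 1) + 1) + 1) (by fun_prop)
    (by fun_prop) (by fun_prop) ?_ fun x t _ => ?_
  · have c := fun n => PolyBdd.const (α := X) n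
    exact (hS.size_bdd.mul (((hS.size_bdd.add (((c 12).mul hq).add (c 1))).add (c 1)).add
      (c 1))).add (c 1)
  · rcases List.eq_nil_or_concat t with rfl | ⟨r, a, rfl⟩
    · simp
    · simp only [List.foldl_append, List.foldl_cons, List.foldl_nil, List.concat_eq_append]
      refine (size_le_of_forall_mem (B := size (S x) + (12 * q x + 1) + 1) ?_).trans ?_
      · intro p hp
        obtain ⟨A, hA, rfl⟩ := List.mem_map.1 hp
        have h₁ := size_le_of_mem hA
        simp only [size_prod]
        have h₂ : ∀ n, size (walkCount (D x) A - n) ≤ 12 * q x + 1 := fun n =>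
          size_le_of_lt_two_pow (((Nat.sub_le _ _).trans_lt (lt_two_pow_size _)).trans_le
            (Nat.pow_le_pow_right (by omega) (hb x A hA)))
        gcongr
        exact h₂ _
      · have := length_le_size (S x)
        unfold refineTable
        rw [List.length_map]
        gcongr

@[fun_prop]
theorem polyTime_deficient {D : X → Net} {T : X → List (List ℕ × ℕ)} {W : X → List ℕ}
    (hD : PolyTime D) (hT : PolyTime T) (hW : PolyTime W) :
    PolyTime fun x => deficient (D x) (T x) (W x) := by
  unfold deficient
  fun_prop

@[fun_prop]
theorem polyTime_deletions {A : X → List ℕ} (hA : PolyTime A) :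
    PolyTime fun x => deletions (A x) := by
  unfold deletions
  fun_prop

@[fun_prop]
theorem polyTime_candidates {S : X → List (List ℕ)} {W : X → List ℕ} (hS : PolyTime S)
    (hW : PolyTime W) : PolyTime fun x => candidates (S x) (W x) := by
  unfold candidates
  fun_prop

@[fun_prop]
theorem polyTime_descend {D : X → Net} {S : X → List (List ℕ)} {T : X → List (List ℕ × ℕ)}
    {W : X → List ℕ} (hD : PolyTime D) (hS : PolyTime S) (hT : PolyTime T) (hW : PolyTime W) :
    PolyTime fun x => descend (D x) (S x) (T x) (W x) := by
  unfold descend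
  fun_prop

theorem mem_candidates {S : List (List ℕ)} {W A : List ℕ} : A ∈ candidates S W ↔
    ∃ B ∈ W :: S, subset B W = true ∧ ∃ u ∈ B, B.filter (fun v => !decide (v = u)) = A := by
  simp only [candidates, deletions, List.mem_flatMap, List.mem_filter, List.mem_map, and_assoc]

theorem descend_eq_or_mem (D : Net) (S : List (List ℕ)) (T : List (List ℕ × ℕ)) (W : List ℕ) :
    descend D S T W = W ∨
      descend D S T W ∈ candidates S W ∧ deficient D T (descend D S T W) = true := by
  unfold descend
  cases h : (candidates S W).find? (deficient D T) with
  | none => exact Or.inl rfl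
  | some A => exact Or.inr ⟨List.mem_of_find?_eq_some h, List.find?_some h⟩

-- A descent step yields a sublist of the current set or of a member of `S`, so sizes stay bounded.
@[fun_prop]
theorem polyTime_descent {D : X → Net} {S : X → List (List ℕ)} {T : X → List (List ℕ × ℕ)}
    {U : X → List ℕ} (hD : PolyTime D) (hS : PolyTime S) (hT : PolyTime T) (hU : PolyTime U) :
    PolyTime fun x => descent (D x) (S x) (T x) (U x) := by
  refine PolyTime.foldl
    (h := fun p : X × List ℕ × ℕ => descend (D p.1) (S p.1) (T p.1) p.2.1)
    (q := fun x => size (S x) + size (U x)) hU hU (by fun_prop) (hS.size_bdd.add hU.size_bdd)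
    fun x t _ => ?_
  have key : ∀ (t : List ℕ) (W : List ℕ), size W ≤ size (S x) + size (U x) →
      size (t.foldl (fun W _ => descend (D x) (S x) (T x) W) W) ≤ size (S x) + size (U x) := by
    intro t
    induction t with
    | nil => intro W hW; exact hW
    | cons a t ih =>
      intro W hW
      refine ih _ ?_
      simp only
      rcases descend_eq_or_mem (D x) (S x) (T x) W with h | ⟨h, _⟩
      · rwa [h]
      · obtain ⟨B, hB, _, u, _, hu⟩ := mem_candidates.1 h
        rw [← hu]
        refine (size_filter_le _ _).trans ?_
        rcases List.mem_cons.1 hB with rfl | hB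
        · exact hW
        · exact (size_le_of_mem hB).trans (Nat.le_add_right _ _)
  exact key t (U x) (Nat.le_add_left _ _)

@[fun_prop]
theorem polyTime_labels {E : X → List Edge} (hE : PolyTime E) : PolyTime fun x => labels (E x) := by
  unfold labels
  fun_prop

theorem polyTime_some {f : X → α} (hf : PolyTime f) : PolyTime fun x => some (f x) :=
  (hf.cons (.const [])).of_enc_eq fun _ => rfl

@[fun_prop]
theorem polyTime_answerOfTable {D : X → Net} {S : X → List (List ℕ)} {T : X → List (List ℕ × ℕ)}
    (hD : PolyTime D) (hS : PolyTime S) (hT : PolyTime T) :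
    PolyTime fun x => answerOfTable (D x) (S x) (T x) := by
  unfold answerOfTable
  exact PolyTime.ite (by fun_prop) (polyTime_some (by fun_prop)) (.const none)

theorem polyTime_answer {D : X → Net} {S : X → List (List ℕ)} (hD : PolyTime D)
    (hS : PolyTime S) : PolyTime fun x => answer (D x) (S x) := by
  unfold answer
  fun_prop

theorem polyTime_codeAnswer {o : X → Option (List ℕ)} (ho : PolyTime o) :
    PolyTime fun x => codeAnswer (o x) := by
  refine PolyTime.list_cases (l := fun x => (o x).toList) (g := fun _ => [CodeSymbol.empty])
    (h := fun p : X × List ℕ × List (List ℕ) => codeList p.2.1) (by fun_prop) (by fun_prop) ?_ ?_ ?_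
  · unfold codeList
    fun_prop
  · intro x h
    cases hx : o x <;> simp_all [codeAnswer]
  · intro x a t h
    cases hx : o x <;> simp_all [codeAnswer]

end NextLabel

/-! ## Correctness of the algorithm -/

namespace NextLabel

theorem subset_iff {A B : List ℕ} : subset A B = true ↔ A.toFinset ⊆ B.toFinset := by
  simp [subset, Finset.subset_iff]

/-- Table entries are summed over the family, so a set listed twice would be counted twice. -/
theorem mem_distinct_and_nodup (S : List (List ℕ)) :
    (∀ Y, Y ∈ (distinct S).map List.toFinset ↔ Y ∈ S.map List.toFinset) ∧
      ((distinct S).map List.toFinset).Nodup := by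
  have key : ∀ S T : List (List ℕ), (T.map List.toFinset).Nodup →
      (∀ Y, Y ∈ (S.foldl (fun T A => if (T.any fun B => subset A B && subset B A) = true then T
          else A :: T) T).map List.toFinset ↔ Y ∈ T.map List.toFinset ∨ Y ∈ S.map List.toFinset) ∧
        ((S.foldl (fun T A => if (T.any fun B => subset A B && subset B A) = true then T
          else A :: T) T).map List.toFinset).Nodup := by
    intro S
    induction S with
    | nil => intro T hT; simpa using hT
    | cons A S ih =>
      intro T hT
      have hA : (T.any fun B => subset A B && subset B A) = true ↔
          A.toFinset ∈ T.map List.toFinset := by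
        simp only [List.any_eq_true, Bool.and_eq_true, subset_iff, List.mem_map]
        exact exists_congr fun B => and_congr_right fun _ =>
          ⟨fun h => h.2.antisymm h.1, fun h => by rw [h]; exact ⟨subset_rfl, subset_rfl⟩⟩
      rw [List.foldl_cons]
      by_cases h : (T.any fun B => subset A B && subset B A) = true
      · rw [if_pos h]
        obtain ⟨h₁, h₂⟩ := ih T hT
        refine ⟨fun Y => (h₁ Y).trans ?_, h₂⟩
        rw [List.map_cons, List.mem_cons]
        constructor
        · tauto
        · rintro (h' | rfl | h')
          exacts [Or.inl h', Or.inl (hA.1 h), Or.inr h']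
      · rw [if_neg h]
        obtain ⟨h₁, h₂⟩ := ih (A :: T) (by
          rw [List.map_cons, List.nodup_cons]; exact ⟨fun h' => h (hA.2 h'), hT⟩)
        refine ⟨fun Y => (h₁ Y).trans ?_, h₂⟩
        simp only [List.map_cons, List.mem_cons]
        tauto
  obtain ⟨h₁, h₂⟩ := key S [] (by simp)
  exact ⟨fun Y => (h₁ Y).trans (by simp), h₂⟩

/-- The elements of a list that satisfy `p` are those that occur in a list without repetitions and
the others. -/
theorem countP_eq_sum_count_add (F : List (Finset ℕ)) (G : List (Finset ℕ)) (hG : G.Nodup)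
    (p : Finset ℕ → Bool) :
    F.countP p = ((G.filter p).map fun Y => F.count Y).sum +
      F.countP (fun Y => p Y && !decide (Y ∈ G)) := by
  induction F with
  | nil => simp
  | cons Y F ih =>
    have h : ((G.filter p).map fun Z => (Y :: F).count Z).sum =
        ((G.filter p).map fun Z => F.count Z).sum + (G.filter p).count Y := by
      generalize G.filter p = H
      induction H with
      | nil => simp
      | cons Z H ihH =>
        rw [List.map_cons, List.sum_cons, ihH, List.map_cons, List.sum_cons, List.count_cons,
          List.count_cons]
        by_cases hZ : Z = Y
        · subst hZ; simp; omega
        · have : ¬ Y = Z := fun h => hZ h.symm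
          simp [hZ, this]; omega
    have h' : (G.filter p).count Y = if p Y = true ∧ Y ∈ G then 1 else 0 := by
      rw [List.Nodup.count (hG.filter p)]
      simp [List.mem_filter, and_comm]
    rw [h, h', List.countP_cons, List.countP_cons, ih]
    by_cases h₁ : p Y = true <;> by_cases h₂ : Y ∈ G <;> simp [h₁, h₂] <;> omega

section Table

variable (D : Net) (S : List (List ℕ)) (F : List (Finset ℕ))

/-- Every set of `F` that is a proper subset of the set presented by `A` belongs to the family. -/
def Verified (A : List ℕ) : Prop :=
  ∀ Y ∈ F, Y ⊂ A.toFinset → Y ∈ S.map List.toFinset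

theorem sum_filter_table {α : Type} (S : List α) (v : α → ℕ) (p : α → Bool) :
    (((S.map fun A => (A, v A)).filter fun q => p q.1).map Prod.snd).sum =
      ((S.filter p).map v).sum := by
  rw [List.filter_map, List.map_map]
  rfl

theorem sum_filter_count (p : Finset ℕ → Bool) :
    ((S.filter fun B => p B.toFinset).map fun B => F.count B.toFinset).sum =
      (((S.map List.toFinset).filter p).map fun Y => F.count Y).sum := by
  rw [List.filter_map, List.map_map]
  rfl

variable {D S F}

/-- The remainder term in `countP_eq_sum_count_add` vanishes. -/
theorem countP_eq_sum_of_forall (hS : (S.map List.toFinset).Nodup) (p : Finset ℕ → Bool)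
    (h : ∀ Y ∈ F, p Y = true → Y ∈ S.map List.toFinset) :
    F.countP p = ((S.filter fun B => p B.toFinset).map fun B => F.count B.toFinset).sum := by
  rw [sum_filter_count, countP_eq_sum_count_add F _ hS p]
  simp only [Nat.add_eq_left, List.countP_eq_zero]
  intro Y hY hp
  simp only [Bool.and_eq_true, Bool.not_eq_true', decide_eq_false_iff_not] at hp
  exact hp.2 (h Y hY hp.1)

theorem countP_subset_sub_eq_count (A : Finset ℕ) :
    F.countP (fun Y => decide (Y ⊆ A)) - F.countP (fun Y => decide (Y ⊂ A)) = F.count A := by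
  have : F.countP (fun Y => decide (Y ⊆ A)) =
      F.countP (fun Y => decide (Y ⊂ A)) + F.count A := by
    induction F with
    | nil => simp
    | cons Y F ih =>
      rw [List.countP_cons, List.countP_cons, List.count_cons, ih]
      by_cases h : Y = A
      · subst h; simp; omega
      · have : Y ⊆ A ↔ Y ⊂ A := ⟨fun h' => h'.ssubset_of_ne h, fun h' => h'.subset⟩
        simp [h, this]; omega
  omega

theorem subset_and_not_subset {A B : List ℕ} :
    (subset B A && !subset A B) = decide (B.toFinset ⊂ A.toFinset) := by
  rw [Bool.eq_iff_iff]
  simp only [Bool.and_eq_true, Bool.not_eq_true', decide_eq_true_eq, subset_iff,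
    ← Bool.not_eq_true, Finset.ssubset_def]

/-- After sufficiently many rounds the entries of verified sets are correct. -/
theorem foldl_refineTable_eq (hS : (S.map List.toFinset).Nodup)
    (hc : ∀ W, walkCount D W = F.countP fun Y => decide (Y ⊆ W.toFinset)) {β : Type} (R : List β)
    (a : β) : ∃ v : List ℕ → ℕ,
      (a :: R).foldl (fun T _ => refineTable D S T) [] = S.map (fun A => (A, v A)) ∧
      ∀ A, Verified S F A → A.toFinset.card ≤ R.length → v A = F.count A.toFinset := by
  induction R using List.reverseRecOn with
  | nil =>
    -- The first round subtracts nothing, which is right for the empty set.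
    refine ⟨fun A => walkCount D A, by simp [refineTable], fun A _ hA => ?_⟩
    have hA' : A.toFinset = ∅ := by simpa using hA
    simp only
    rw [hc, ← countP_subset_sub_eq_count, hA']
    simp [Finset.not_ssubset_empty]
  | append_singleton R b ih =>
    obtain ⟨v, hv, hcount⟩ := ih
    refine ⟨fun A => walkCount D A - ((S.filter fun B => subset B A && !subset A B).map v).sum,
      ?_, fun A hA hcard => ?_⟩
    · rw [← List.cons_append, List.foldl_append, hv]
      simp only [List.foldl_cons, List.foldl_nil, refineTable]
      refine List.map_congr_left fun A _ => ?_
      rw [sum_filter_table S v fun B => subset B A && !subset A B]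
    · have h₁ : ((S.filter fun B => subset B A && !subset A B).map v).sum =
          F.countP fun Y => decide (Y ⊂ A.toFinset) := by
        rw [countP_eq_sum_of_forall hS (fun Y => decide (Y ⊂ A.toFinset))
          fun Y hY h => hA Y hY (of_decide_eq_true h)]
        simp only [subset_and_not_subset]
        congr 1
        refine List.map_congr_left fun B hB => ?_
        have hB' : B.toFinset ⊂ A.toFinset := by simpa using (List.mem_filter.1 hB).2
        -- A proper subset of a verified set is verified and smaller, so the previous round already
        -- had its exact number.
        refine hcount B (fun Y hY hYB => hA Y hY (hYB.trans hB')) ?_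
        have := Finset.card_lt_card hB'
        simp at hcard
        omega
      simp only
      rw [h₁, hc, countP_subset_sub_eq_count]

/-- With correct entries, the count exceeds the table sum by the number of entries of `F` inside `W`
that lie outside the family. -/
theorem deficient_iff (hS : (S.map List.toFinset).Nodup)
    (hc : ∀ W, walkCount D W = F.countP fun Y => decide (Y ⊆ W.toFinset)) {v : List ℕ → ℕ}
    {W : List ℕ} (hv : ∀ B ∈ S, B.toFinset ⊆ W.toFinset → v B = F.count B.toFinset) :
    deficient D (S.map fun A => (A, v A)) W = true ↔
      ∃ Y ∈ F, Y ⊆ W.toFinset ∧ Y ∉ S.map List.toFinset := by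
  have h₁ : ((S.filter fun B => subset B W).map v).sum =
      ((S.filter fun B => decide (B.toFinset ⊆ W.toFinset)).map
        fun B => F.count B.toFinset).sum := by
    have : ∀ B, subset B W = decide (B.toFinset ⊆ W.toFinset) := fun B => by
      rw [Bool.eq_iff_iff, subset_iff, decide_eq_true_eq]
    simp only [this]
    congr 1
    refine List.map_congr_left fun B hB => ?_
    rw [List.mem_filter] at hB
    exact hv B hB.1 (of_decide_eq_true hB.2)
  unfold deficient
  rw [sum_filter_table S v fun B => subset B W, h₁, hc,
    sum_filter_count S F fun Y => decide (Y ⊆ W.toFinset), countP_eq_sum_count_add F _ hS]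
  simp only [Bool.not_eq_true', decide_eq_false_iff_not, Nat.add_eq_left, List.countP_eq_zero]
  simp

end Table

/-- No candidate below `W` is deficient. -/
def Stable (D : Net) (S : List (List ℕ)) (T : List (List ℕ × ℕ)) (W : List ℕ) : Prop :=
  ∀ A ∈ candidates S W, deficient D T A = false

theorem card_lt_of_mem_candidates {S : List (List ℕ)} {W A : List ℕ} (h : A ∈ candidates S W) :
    A.toFinset.card < W.toFinset.card := by
  obtain ⟨B, _, hB, u, hu, rfl⟩ := mem_candidates.1 h
  rw [subset_iff] at hB
  refine Finset.card_lt_card (Finset.ssubset_iff_subset_ne.2 ⟨?_, ?_⟩)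
  · intro x hx
    simp only [List.mem_toFinset, List.mem_filter] at hx
    exact hB (List.mem_toFinset.2 hx.1)
  · intro h
    have : u ∈ W.toFinset := hB (List.mem_toFinset.2 hu)
    rw [← h] at this
    simp at this

theorem descend_of_stable {D : Net} {S : List (List ℕ)} {T : List (List ℕ × ℕ)} {W : List ℕ}
    (h : Stable D S T W) : descend D S T W = W := by
  rcases descend_eq_or_mem D S T W with h' | ⟨h₁, h₂⟩
  · exact h'
  · rw [h _ h₁] at h₂; simp at h₂

theorem descend_of_not_stable {D : Net} {S : List (List ℕ)} {T : List (List ℕ × ℕ)} {W : List ℕ}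
    (h : ¬ Stable D S T W) : descend D S T W ∈ candidates S W := by
  unfold descend
  cases hf : (candidates S W).find? (deficient D T) with
  | none =>
    exact absurd (fun A hA => by simpa using List.find?_eq_none.1 hf A hA) h
  | some A => exact List.mem_of_find?_eq_some hf

/-- At an unstable set a step lowers the cardinality, and stable sets are fixed; hence as many steps
as there are elements suffice. -/
theorem stable_foldl_descend (D : Net) (S : List (List ℕ)) (T : List (List ℕ × ℕ)) {β : Type}
    (R : List β) (W : List ℕ) (h : W.toFinset.card ≤ R.length) :
    Stable D S T (R.foldl (fun W _ => descend D S T W) W) := by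
  induction R generalizing W with
  | nil =>
    intro A hA
    have := card_lt_of_mem_candidates hA
    simp only [List.foldl_nil, List.length_nil] at *
    omega
  | cons a R ih =>
    rw [List.foldl_cons]
    by_cases hW : Stable D S T W
    · rw [descend_of_stable hW]
      clear ih h
      induction R with
      | nil => exact hW
      | cons b R ihR => rw [List.foldl_cons, descend_of_stable hW]; exact ihR
    · have := card_lt_of_mem_candidates (descend_of_not_stable hW)
      refine ih _ ?_
      simp only [List.length_cons] at h
      omega

/-- A step either stays or lands in a deficient set. Thus a final set that is not deficient is the
initial one, which justifies the answer `none`. -/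
theorem foldl_descend_eq_or_deficient (D : Net) (S : List (List ℕ)) (T : List (List ℕ × ℕ))
    {β : Type} (R : List β) (W : List ℕ) :
    R.foldl (fun W _ => descend D S T W) W = W ∨
      deficient D T (R.foldl (fun W _ => descend D S T W) W) = true := by
  induction R using List.reverseRecOn with
  | nil => exact Or.inl rfl
  | append_singleton R a ih =>
    simp only [List.foldl_append, List.foldl_cons, List.foldl_nil]
    rcases descend_eq_or_mem D S T (R.foldl (fun W _ => descend D S T W) W) with h | h
    · rw [h]; exact ih
    · exact Or.inr h.2

/-- Delete an element of `B` that is not in `Y`. -/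
theorem exists_deletion {S : List (List ℕ)} {B W : List ℕ} (hB : B ∈ W :: S)
    (hBW : B.toFinset ⊆ W.toFinset) {Y : Finset ℕ} (hY : Y ⊂ B.toFinset) :
    ∃ A ∈ candidates S W, Y ⊆ A.toFinset ∧ A.toFinset ⊂ B.toFinset := by
  obtain ⟨u, hu, huY⟩ := Finset.exists_of_ssubset hY
  refine ⟨B.filter fun v => !decide (v = u),
    mem_candidates.2 ⟨B, hB, subset_iff.2 hBW, u, List.mem_toFinset.1 hu, rfl⟩, ?_, ?_⟩
  · intro x hx
    have : x ≠ u := by rintro rfl; exact huY hx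
    simpa [this] using hY.subset hx
  · refine Finset.ssubset_iff_subset_ne.2 ⟨?_, ?_⟩
    · intro x hx
      simp only [List.mem_toFinset, List.mem_filter] at hx
      exact List.mem_toFinset.2 hx.1
    · intro h
      rw [← h] at hu
      simp at hu

/-- If the walks of a net have the label sets `F`, then the algorithm decides whether `F` is
contained in the family, and finds a member of `F` outside of the family otherwise. -/
theorem answer_correct {D : Net} {S : List (List ℕ)} {F : List (Finset ℕ)}
    (hc : ∀ W, walkCount D W = F.countP fun Y => decide (Y ⊆ W.toFinset))
    (hF : ∀ Y ∈ F, Y ⊆ (labels D.1).toFinset) (hS : ∀ A ∈ S, A.toFinset ∈ F) :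
    match answer D S with
    | none => ∀ Y ∈ F, Y ∈ S.map List.toFinset
    | some W => W.toFinset ∈ F ∧ W.toFinset ∉ S.map List.toFinset := by
  obtain ⟨hmem, hnodup⟩ := mem_distinct_and_nodup S
  simp only [← hmem]
  have hS' : ∀ A ∈ distinct S, A.toFinset ∈ F := by
    intro A hA
    obtain ⟨B, hB, h⟩ := List.mem_map.1 ((hmem _).1 (List.mem_map_of_mem hA))
    rw [← h]
    exact hS B hB
  unfold answer
  generalize distinct S = S at *
  obtain ⟨v, hT, hv⟩ := foldl_refineTable_eq hnodup hc (labels D.1) 0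
  rw [exactTable, hT]
  set T := S.map fun A => (A, v A) with hTdef
  set U := labels D.1
  -- Members of the family consist of edge labels, so the number of rounds covers their cardinality.
  have hvS : ∀ B ∈ S, Verified S F B → v B = F.count B.toFinset := fun B hB h =>
    hv B h ((Finset.card_le_card (hF _ (hS' B hB))).trans (List.toFinset_card_le _))
  have hstable : Stable D S T (descent D S T U) :=
    stable_foldl_descend D S T U U (List.toFinset_card_le _)
  have hdesc : descent D S T U = U ∨ deficient D T (descent D S T U) = true :=
    foldl_descend_eq_or_deficient D S T U U
  unfold answerOfTable
  generalize descent D S T U = W at *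
  -- Induction on cardinality: a missing `Y` properly inside `B` survives in a deletion `A` of `B`.
  -- Members of the family inside `A` are smaller than `B`, so their entries are right and `A` is
  -- deficient, against stability.
  have hver : ∀ n, ∀ B ∈ S, B.toFinset ⊆ W.toFinset → B.toFinset.card = n → Verified S F B := by
    intro n
    induction n using Nat.strong_induction_on with
    | _ n ih =>
      intro B hB hBW hn Y hY hYB
      by_contra hYS
      obtain ⟨A, hA, hYA, hAB⟩ := exists_deletion (List.mem_cons_of_mem W hB) hBW hYB
      have h := (deficient_iff hnodup hc (v := v) (W := A) fun C hC hCA => hvS C hC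
        (ih _ (hn ▸ Finset.card_lt_card (hCA.trans_ssubset hAB)) C hC
          (hCA.trans (hAB.subset.trans hBW)) rfl)).2 ⟨Y, hY, hYA, hYS⟩
      rw [hstable A hA] at h
      simp at h
  have hdef : ∀ A : List ℕ, A.toFinset ⊆ W.toFinset → (deficient D T A = true ↔
      ∃ Y ∈ F, Y ⊆ A.toFinset ∧ Y ∉ S.map List.toFinset) := fun A hA =>
    deficient_iff hnodup hc fun C hC hCA => hvS C hC (hver _ C hC (hCA.trans hA) rfl)
  by_cases hW : deficient D T W = true
  · rw [if_pos hW]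
    obtain ⟨Y, hY, hYW, hYS⟩ := (hdef W subset_rfl).1 hW
    rcases eq_or_ne Y W.toFinset with rfl | hne
    · exact ⟨hY, hYS⟩
    -- A missing set properly inside `W` would make a deletion of `W` deficient; so `W` itself is
    -- missing.
    · obtain ⟨A, hA, hYA, hAW⟩ := exists_deletion (S := S) List.mem_cons_self subset_rfl
        (hYW.ssubset_of_ne hne)
      have h := (hdef A hAW.subset).2 ⟨Y, hY, hYA, hYS⟩
      rw [hstable A hA] at h
      simp at h
  · rw [if_neg hW]
    intro Y hY
    have hWU : W = U := hdesc.resolve_right hW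
    by_contra hYS
    exact hW ((hdef W subset_rfl).2 ⟨Y, hY, hWU ▸ hF Y hY, hYS⟩)

/-! ### Counting walks by dynamic programming -/

/-- The label sets of all walks of length `n` from `v` to `t`, with multiplicities. -/
def walkSets (E : List Edge) (t : ℕ) : ℕ → ℕ → List (Finset ℕ)
  | 0, v => if v = t then [∅] else []
  | n + 1, v => (E.filter fun e => decide (e.1 = v)).flatMap fun e =>
      (walkSets E t n e.2.1).map fun Y => e.2.2.toList.toFinset ∪ Y

/-- Prepending an edge keeps the labels inside `W` exactly if the edge is allowed; each allowed edge
from `v` contributes the count at its target. -/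
theorem lookup_walkStep (E : List Edge) (W : List ℕ) (t n : ℕ) (T : List (ℕ × ℕ))
    (h : ∀ v, lookup T v = (walkSets E t n v).countP fun Y => decide (Y ⊆ W.toFinset)) (v : ℕ) :
    lookup (walkStep E W T) v =
      (walkSets E t (n + 1) v).countP fun Y => decide (Y ⊆ W.toFinset) := by
  -- The induction varies only the list of first edges; the walks that follow still use all of `E`.
  have key : ∀ E' : List Edge, lookup ((E'.filter (allowed W)).map fun e => (e.1, lookup T e.2.1)) v
      = ((E'.filter fun e => decide (e.1 = v)).flatMap fun e => (walkSets E t n e.2.1).map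
        fun Y => e.2.2.toList.toFinset ∪ Y).countP fun Y => decide (Y ⊆ W.toFinset) := by
    intro E'
    induction E' with
    | nil => rfl
    | cons e E' ih =>
      have he : allowed W e = true ↔ e.2.2.toList.toFinset ⊆ W.toFinset := by
        simp [allowed, Finset.subset_iff]
      unfold lookup at ih ⊢
      by_cases h₁ : e.1 = v <;> by_cases h₂ : allowed W e = true
      · have h₃ : ((fun Y => decide (Y ⊆ W.toFinset)) ∘ fun Y => e.2.2.toList.toFinset ∪ Y) =
            fun Y => decide (Y ⊆ W.toFinset) := by
          funext Y; simp [Finset.union_subset_iff, he.1 h₂]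
        have h₄ := h e.2.1
        unfold lookup at h₄
        simp [h₁, h₂, ih, List.countP_map, h₃, h₄]
      · have h₃ : ((fun Y => decide (Y ⊆ W.toFinset)) ∘ fun Y => e.2.2.toList.toFinset ∪ Y) =
            fun _ => false := by
          funext Y; simp [Finset.union_subset_iff, mt he.2 h₂]
        simp [h₁, h₂, ih, List.countP_map, h₃]
      · simp [h₁, h₂, ih]
      · simp [h₁, h₂, ih]
  exact key E

theorem walkCount_eq (E : List Edge) (R : List Unit) (s t : ℕ) (W : List ℕ) :
    walkCount (E, R, s, t) W =
      (walkSets E t R.length s).countP fun Y => decide (Y ⊆ W.toFinset) := by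
  have key : ∀ v, lookup (R.foldl (fun T _ => walkStep E W T) [(t, 1)]) v =
      (walkSets E t R.length v).countP fun Y => decide (Y ⊆ W.toFinset) := by
    induction R using List.reverseRecOn with
    | nil =>
      intro v
      by_cases h : v = t
      · subst h; simp [lookup, walkSets]
      · have : ¬ t = v := fun h' => h h'.symm
        simp [lookup, walkSets, h, this]
    | append_singleton R a ih =>
      intro v
      rw [List.foldl_append, List.length_append]
      exact lookup_walkStep E W t _ _ ih v
  exact key s

theorem subset_labels_of_mem_walkSets (E : List Edge) (t n v : ℕ) {Y : Finset ℕ}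
    (h : Y ∈ walkSets E t n v) : Y ⊆ (labels E).toFinset := by
  induction n generalizing v Y with
  | zero =>
    unfold walkSets at h
    split_ifs at h
    · simp_all
    · simp at h
  | succ n ih =>
    simp only [walkSets, List.mem_flatMap, List.mem_filter, List.mem_map] at h
    obtain ⟨e, ⟨he, _⟩, Z, hZ, rfl⟩ := h
    refine Finset.union_subset ?_ (ih _ hZ)
    intro u hu
    simp only [labels, List.mem_toFinset, List.mem_flatMap]
    exact ⟨e, he, by simpa using hu⟩

end NextLabel

/-! ### Shortening paths -/

namespace TransitionGraph

variable {V E U : Type*}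

theorem isPath_append {G : TransitionGraph V E U} {p q : List E} {v w : V} :
    G.IsPath v (p ++ q) w ↔ ∃ u, G.IsPath v p u ∧ G.IsPath u q w := by
  induction p generalizing v with
  | nil =>
    constructor
    · intro h; exact ⟨v, .nil v, h⟩
    · rintro ⟨u, h₁, h₂⟩; cases h₁; exact h₂
  | cons e p ih =>
    constructor
    · intro h
      cases h with
      | cons _ _ _ h =>
        obtain ⟨u, h₁, h₂⟩ := ih.1 h
        exact ⟨u, .cons e p u h₁, h₂⟩
    · rintro ⟨u, h₁, h₂⟩
      cases h₁ with
      | cons _ _ _ h₁ => exact .cons e _ w (ih.2 ⟨u, h₁, h₂⟩)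

variable [DecidableEq U]

theorem labelSet_append (G : TransitionGraph V E U) (p q : List E) :
    G.labelSet (p ++ q) = G.labelSet p ∪ G.labelSet q := by
  simp [labelSet]

theorem card_labelSet_le [Fintype E] (G : TransitionGraph V E U) (p : List E) :
    (G.labelSet p).card ≤ Fintype.card E := by
  have h : G.labelSet p ⊆ (Finset.univ.toList.filterMap G.label : List U).toFinset := by
    intro u hu
    simp only [labelSet, List.mem_toFinset, List.mem_filterMap] at hu ⊢
    obtain ⟨e, _, he⟩ := hu
    exact ⟨e, by simp, he⟩
  refine (Finset.card_le_card h).trans ((List.toFinset_card_le _).trans ?_)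
  refine (List.length_filterMap_le _ _).trans ?_
  simp

/-- Every path can be shortened, keeping its ends and its label set, to a path whose length is
bounded in terms of the size of the graph. -/
theorem exists_short_path [Fintype V] [Fintype E] (G : TransitionGraph V E U) {v w : V} (p : List E)
    (hp : G.IsPath v p w) : ∃ q, G.IsPath v q w ∧ G.labelSet q = G.labelSet p ∧
      q.length ≤ Fintype.card V * (Fintype.card E + 1) := by
  induction hn : p.length using Nat.strong_induction_on generalizing p with
  | _ n ih =>
    by_cases hle : n ≤ Fintype.card V * (Fintype.card E + 1)
    · exact ⟨p, hp, rfl, hn ▸ hle⟩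
    · have hsplit : ∀ i : Fin (n + 1), ∃ u, G.IsPath v (p.take i) u ∧ G.IsPath u (p.drop i) w :=
        fun i => isPath_append.1 (by rwa [List.take_append_drop])
      choose u hu₁ hu₂ using hsplit
      -- Pigeonhole: `n + 1` prefixes, but only `|V| (|E| + 1)` pairs of an end vertex and a number
      -- of labels.
      obtain ⟨i, j, hij, h⟩ := Fintype.exists_ne_map_eq_of_card_lt
        (fun i : Fin (n + 1) => ((u i, ⟨(G.labelSet (p.take i)).card,
          Nat.lt_succ_of_le (G.card_labelSet_le _)⟩) : V × Fin (Fintype.card E + 1))) (by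
          simp only [Fintype.card_prod, Fintype.card_fin]; omega)
      wlog hlt : i < j generalizing i j
      · exact this j i hij.symm h.symm (lt_of_le_of_ne (not_lt.1 hlt) hij.symm)
      simp only [Prod.mk.injEq, Fin.mk.injEq] at h
      have hsub : G.labelSet (p.take i) ⊆ G.labelSet (p.take j) := by
        have e : p.take j = p.take i ++ (p.take j).drop i := by
          conv_lhs => rw [← List.take_append_drop i (p.take j), List.take_take,
            min_eq_left (Fin.le_def.1 hlt.le)]
        rw [e, labelSet_append]
        exact Finset.subset_union_left
      -- Label sets of prefixes increase, so equal cardinality forces equality and the segment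
      -- between can be removed.
      have hset : G.labelSet (p.take i) = G.labelSet (p.take j) :=
        Finset.eq_of_subset_of_card_le hsub h.2.ge
      obtain ⟨q, hq₁, hq₂, hq₃⟩ := ih (p.take i ++ p.drop j).length (by
          have := i.2; have := j.2; have : (i : ℕ) < j := hlt
          simp only [List.length_append, List.length_take, List.length_drop]; omega)
        (p.take i ++ p.drop j) (isPath_append.2 ⟨u i, hu₁ i, h.1 ▸ hu₂ j⟩) rfl
      refine ⟨q, hq₁, hq₂.trans ?_, hq₃⟩
      conv_rhs => rw [← List.take_append_drop j p, labelSet_append]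
      rw [labelSet_append, hset]

end TransitionGraph

/-! ### Walks of fixed length and the label family -/

namespace NextLabel

/-- The edge with the given name, as a triple of numbers. -/
def edge {n k : ℕ} (G : TransitionGraph (Fin n) (Fin k) ℕ) (e : Fin k) : Edge :=
  (G.src e, G.tgt e, G.label e)

/-- The edges of a transition graph and an unlabelled loop at the terminal vertex. -/
def edges {n k : ℕ} (G : TransitionGraph (Fin n) (Fin k) ℕ) : List Edge :=
  ((G.terminal : ℕ), (G.terminal : ℕ), none) :: (List.finRange k).map (edge G)

/-- Traversals of the added loop are dropped; they contribute no label. -/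
theorem exists_path_of_mem_walkSets {n k : ℕ} (G : TransitionGraph (Fin n) (Fin k) ℕ) (i : ℕ)
    (v : Fin n) {Y : Finset ℕ} (h : Y ∈ walkSets (edges G) G.terminal i v) :
    ∃ p, G.IsPath v p G.terminal ∧ G.labelSet p = Y := by
  induction i generalizing v Y with
  | zero =>
    unfold walkSets at h
    split_ifs at h with hv
    · have : v = G.terminal := Fin.ext hv
      subst this
      exact ⟨[], .nil _, by simp_all [TransitionGraph.labelSet]⟩
    · simp at h
  | succ i ih =>
    simp only [walkSets, List.mem_flatMap, List.mem_filter, List.mem_map, edges, List.mem_cons,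
      decide_eq_true_eq] at h
    obtain ⟨e, ⟨he | ⟨a, _, rfl⟩, hv⟩, Z, hZ, rfl⟩ := h
    · subst he
      have : v = G.terminal := Fin.ext hv.symm
      subst this
      obtain ⟨p, hp, hp'⟩ := ih G.terminal hZ
      exact ⟨p, hp, by simp [hp']⟩
    · have : v = G.src a := Fin.ext hv.symm
      subst this
      obtain ⟨p, hp, rfl⟩ := ih (G.tgt a) hZ
      refine ⟨a :: p, .cons a p _ hp, ?_⟩
      cases hl : G.label a <;> simp [TransitionGraph.labelSet, edge, hl]

/-- A short path is padded at its end by the loop at the terminal vertex. -/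
theorem mem_walkSets_of_path {n k : ℕ} (G : TransitionGraph (Fin n) (Fin k) ℕ) (i : ℕ)
    (v : Fin n) (p : List (Fin k)) (hp : G.IsPath v p G.terminal) (hi : p.length ≤ i) :
    G.labelSet p ∈ walkSets (edges G) G.terminal i v := by
  induction i generalizing v p with
  | zero =>
    have : p = [] := by simpa using hi
    subst this
    cases hp
    simp [walkSets, TransitionGraph.labelSet]
  | succ i ih =>
    simp only [walkSets, List.mem_flatMap, List.mem_filter, List.mem_map, decide_eq_true_eq]
    cases hp with
    | nil =>
      exact ⟨_, ⟨List.mem_cons_self, rfl⟩, _, ih _ [] (.nil _) (by simp), by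
        simp [TransitionGraph.labelSet]⟩
    | cons e p _ hp =>
      refine ⟨edge G e, ⟨List.mem_cons_of_mem _ (List.mem_map_of_mem (List.mem_finRange e)), rfl⟩,
        _, ih _ p hp (by simpa using hi), ?_⟩
      cases hl : G.label e <;> simp [TransitionGraph.labelSet, edge, hl]

theorem mem_walkSets_iff {n k : ℕ} (G : TransitionGraph (Fin n) (Fin k) ℕ) {i : ℕ}
    (hi : n * (k + 1) ≤ i) (Y : Finset ℕ) :
    Y ∈ walkSets (edges G) G.terminal i G.start ↔ Y ∈ G.labelFamily := by
  constructor
  · exact exists_path_of_mem_walkSets G i G.start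
  · rintro ⟨p, hp, rfl⟩
    obtain ⟨q, hq, hqp, hlen⟩ := G.exists_short_path p hp
    rw [← hqp]
    exact mem_walkSets_of_path G i _ q hq (hlen.trans (by simpa using hi))

/-- The net that belongs to an instance of the problem. -/
def net (I : NextLabelInput) : Net :=
  -- With the loop there are `k + 1` edges, so this list has length `n * (k + 1)`, the bound of
  -- `exists_short_path`.
  (edges I.graph, (List.range I.numVertices).flatMap fun _ => (edges I.graph).map fun _ => (),
    I.graph.start, I.graph.terminal)

theorem isAnswer_answer (I : NextLabelInput) : I.IsAnswer (answer (net I) I.sets) := by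
  set F := walkSets (edges I.graph) I.graph.terminal (net I).2.1.length I.graph.start with hF
  have hmem : ∀ Y, Y ∈ F ↔ Y ∈ I.graph.labelFamily := fun Y =>
    mem_walkSets_iff I.graph (by simp [net, edges]) Y
  have h := answer_correct (D := net I) (S := I.sets) (F := F)
    (fun W => walkCount_eq _ _ _ _ _) (fun Y hY => subset_labels_of_mem_walkSets _ _ _ _ hY)
    (fun A hA => (hmem _).2 (I.sets_subset ⟨A, hA, rfl⟩))
  have hfam : ∀ Y, Y ∈ I.sets.map List.toFinset ↔ Y ∈ familyOfLists I.sets := fun Y => by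
    simp [familyOfLists]
  cases ha : answer (net I) I.sets with
  | none =>
    rw [ha] at h
    exact Set.Subset.antisymm (fun Y hY => (hfam Y).1 (h Y ((hmem Y).2 hY))) I.sets_subset
  | some W =>
    rw [ha] at h
    exact ⟨(hmem _).1 h.1, fun h' => h.2 ((hfam _).2 h')⟩

end NextLabel

/-! ## Reading the input -/

namespace NextLabel

open StackProgram
open StackProgram.Enc (enc)

variable {X : Type} [Enc X]

/-- Words over the alphabet of the codes. -/
abbrev Word := List CodeSymbol

/-- One step in the decomposition of a word at the separators. -/
def splitStep (sep : CodeSymbol) (s : List Word × Word) (a : CodeSymbol) : List Word × Word :=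
  if a = sep then (s.2.reverse :: s.1, []) else (s.1, a :: s.2)

/-- The parts of a word that are terminated by a separator. -/
def split (sep : CodeSymbol) (w : Word) : List Word :=
  (w.foldl (splitStep sep) ([], [])).1.reverse

theorem split_flatMap (sep : CodeSymbol) (L : List Word) (h : ∀ w ∈ L, sep ∉ w) :
    split sep (L.flatMap fun w => w ++ [sep]) = L := by
  have key₁ : ∀ (w : Word), sep ∉ w → ∀ (d : List Word) (r : Word),
      w.foldl (splitStep sep) (d, r) = (d, w.reverse ++ r) := by
    intro w
    induction w with
    | nil => intro _ d r; rfl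
    | cons a w ih =>
      intro hw d r
      rw [List.mem_cons, not_or] at hw
      rw [List.foldl_cons, splitStep, if_neg (Ne.symm hw.1), ih hw.2]
      simp
  have key₂ : ∀ (L : List Word), (∀ w ∈ L, sep ∉ w) → ∀ d : List Word,
      (L.flatMap fun w => w ++ [sep]).foldl (splitStep sep) (d, []) = (L.reverse ++ d, []) := by
    intro L
    induction L with
    | nil => intro _ d; rfl
    | cons w L ih =>
      intro hL d
      rw [List.flatMap_cons, List.foldl_append, List.foldl_append,
        key₁ w (hL w List.mem_cons_self)]
      simp only [List.foldl_cons, List.foldl_nil, splitStep, if_true]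
      rw [ih fun w hw => hL w (List.mem_cons_of_mem _ hw)]
      simp
  rw [split, key₂ L h]
  simp

theorem size_reverse {α : Type} [Enc α] (l : List α) : size l.reverse = size l := by
  induction l with
  | nil => rfl
  | cons a l ih =>
    have := size_append l.reverse [a]
    rw [List.reverse_cons]
    simp only [size_cons, size_nil] at *
    omega

@[fun_prop]
theorem polyTime_split (sep : CodeSymbol) {w : X → Word} (hw : PolyTime w) :
    PolyTime fun x => split sep (w x) := by
  have key : PolyTime fun x => (w x).foldl (splitStep sep) ([], []) := by
    refine PolyTime.foldl_of_le_add (h := fun _ s a => splitStep sep s a) (q := fun _ => 12) hw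
      (by fun_prop) ?_ (.const 12) fun x s a _ => ?_
    · unfold splitStep
      fun_prop
    · have := size_symbol_le a
      unfold splitStep
      split_ifs
      · simp only [size_prod, size_cons, size_nil, size_reverse]; omega
      · simp only [size_prod, size_cons]; omega
  unfold split
  fun_prop

/-- One step in the grouping of a list into triples. -/
def groupStep (s : List (Word × Word × Word) × List Word) (w : Word) :
    List (Word × Word × Word) × List Word :=
  if s.2.isEmpty = true then (s.1, [w])
  else if s.2.tail.isEmpty = true then (s.1, w :: s.2)
  else ((s.2.tail.headD [], s.2.headD [], w) :: s.1, [])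

/-- Group a list into triples. -/
def group (l : List Word) : List (Word × Word × Word) := (l.foldl groupStep ([], [])).1.reverse

theorem group_flatMap (L : List (Word × Word × Word)) :
    group (L.flatMap fun t => [t.1, t.2.1, t.2.2]) = L := by
  have key : ∀ (L d : List (Word × Word × Word)),
      (L.flatMap fun t => [t.1, t.2.1, t.2.2]).foldl groupStep (d, []) = (L.reverse ++ d, []) := by
    intro L
    induction L with
    | nil => intro d; rfl
    | cons t L ih =>
      intro d
      rw [List.flatMap_cons, List.foldl_append]
      refine (ih (t :: d)).trans ?_
      simp
  rw [group, key]
  simp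

@[fun_prop]
theorem polyTime_group {l : X → List Word} (hl : PolyTime l) : PolyTime fun x => group (l x) := by
  have key : PolyTime fun x => (l x).foldl groupStep ([], []) := by
    refine PolyTime.foldl_of_le_add (h := fun _ s a => groupStep s a)
      (q := fun x => size (l x) + 10) hl (by fun_prop) ?_ (hl.size_bdd.add (.const 10))
      fun x s a ha => ?_
    · unfold groupStep
      fun_prop
    · have := size_le_of_mem ha
      obtain ⟨d, r⟩ := s
      unfold groupStep
      rcases r with _ | ⟨u, _ | ⟨v, r⟩⟩
      · simp only [List.isEmpty_nil, if_true, size_prod, size_cons, size_nil]; omega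
      · simp only [List.isEmpty_cons, Bool.false_eq_true, if_false, List.tail_cons,
          List.isEmpty_nil, if_true, size_prod, size_cons, size_nil]
        omega
      · simp only [List.isEmpty_cons, Bool.false_eq_true, if_false, List.tail_cons,
          List.headD_cons, size_prod, size_cons, size_nil]
        omega
  unfold group
  fun_prop

theorem mem_codeNat {n : ℕ} {a : CodeSymbol} (h : a ∈ codeNat n) : a = .zero ∨ a = .one := by
  obtain ⟨b, _, rfl⟩ := List.mem_map.1 h
  cases b <;> simp

theorem mem_codeLabel {o : Option ℕ} {a : CodeSymbol} (h : a ∈ codeLabel o) :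
    a = .zero ∨ a = .one ∨ a = .empty := by
  cases o with
  | none => exact Or.inr (Or.inr (by simpa [codeLabel] using h))
  | some u => rcases mem_codeNat h with h | h <;> simp [h]

theorem mem_codeList {l : List ℕ} {a : CodeSymbol} (h : a ∈ codeList l) :
    a = .zero ∨ a = .one ∨ a = .comma := by
  obtain ⟨n, _, h⟩ := List.mem_flatMap.1 h
  rcases List.mem_append.1 h with h | h
  · rcases mem_codeNat h with h | h <;> simp [h]
  · simp_all

theorem split_codeList (l : List ℕ) : split .comma (codeList l) = l.map codeNat := by
  have : codeList l = (l.map codeNat).flatMap fun w => w ++ [CodeSymbol.comma] := by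
    simp [codeList, List.flatMap_map]
  rw [this, split_flatMap]
  intro w hw h
  obtain ⟨n, _, rfl⟩ := List.mem_map.1 hw
  rcases mem_codeNat h with h | h <;> simp at h

/-- The word for all edges. -/
def codeEdges {n k : ℕ} (G : TransitionGraph (Fin n) (Fin k) ℕ) : Word :=
  (List.finRange k).flatMap fun e => codeList [(G.src e : ℕ), (G.tgt e : ℕ)] ++
    codeLabel (G.label e) ++ [CodeSymbol.comma]

/-- The word for all sets of the family. -/
def codeSets (L : List (List ℕ)) : Word := L.flatMap fun l => codeList l ++ [CodeSymbol.semicolon]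

theorem mem_codeEdges {n k : ℕ} {G : TransitionGraph (Fin n) (Fin k) ℕ} {a : CodeSymbol}
    (h : a ∈ codeEdges G) : a ≠ .bar := by
  obtain ⟨e, _, h⟩ := List.mem_flatMap.1 h
  rintro rfl
  rcases List.mem_append.1 h with h | h
  · rcases List.mem_append.1 h with h | h
    · simpa using mem_codeList h
    · simpa using mem_codeLabel h
  · simp at h

theorem mem_codeSets {L : List (List ℕ)} {a : CodeSymbol} (h : a ∈ codeSets L) : a ≠ .bar := by
  obtain ⟨l, _, h⟩ := List.mem_flatMap.1 h
  rintro rfl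
  rcases List.mem_append.1 h with h | h
  · simpa using mem_codeList h
  · simp at h

/-- The appended bar terminates the last part, which the input format leaves open. -/
theorem split_code (I : NextLabelInput) : split .bar (I.code ++ [CodeSymbol.bar]) =
    [codeList (List.range I.numVertices), codeList [(I.graph.start : ℕ), (I.graph.terminal : ℕ)],
      codeEdges I.graph, codeSets I.sets] := by
  have : I.code ++ [CodeSymbol.bar] = [codeList (List.range I.numVertices),
      codeList [(I.graph.start : ℕ), (I.graph.terminal : ℕ)], codeEdges I.graph,
      codeSets I.sets].flatMap fun w => w ++ [CodeSymbol.bar] := by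
    simp only [NextLabelInput.code, codeGraph, codeEdges, codeSets, List.flatMap_cons,
      List.flatMap_nil, List.append_assoc, List.append_nil, List.cons_append, List.nil_append]
  rw [this, split_flatMap]
  intro w hw h
  simp only [List.mem_cons, List.not_mem_nil, or_false] at hw
  rcases hw with rfl | rfl | rfl | rfl
  · simpa using mem_codeList h
  · simpa using mem_codeList h
  · exact mem_codeEdges h rfl
  · exact mem_codeSets h rfl

theorem split_codeSets (L : List (List ℕ)) : split .semicolon (codeSets L) = L.map codeList := by
  have : codeSets L = (L.map codeList).flatMap fun w => w ++ [CodeSymbol.semicolon] := by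
    simp [codeSets, List.flatMap_map]
  rw [this, split_flatMap]
  intro w hw h
  obtain ⟨l, _, rfl⟩ := List.mem_map.1 hw
  simpa using mem_codeList h

/-- The words for the parts of an edge. -/
def edgeWords {n k : ℕ} (G : TransitionGraph (Fin n) (Fin k) ℕ) (e : Fin k) : Word × Word × Word :=
  (codeNat (G.src e), codeNat (G.tgt e), codeLabel (G.label e))

theorem group_split_codeEdges {n k : ℕ} (G : TransitionGraph (Fin n) (Fin k) ℕ) :
    group (split .comma (codeEdges G)) = (List.finRange k).map (edgeWords G) := by
  have : codeEdges G = (((List.finRange k).map (edgeWords G)).flatMap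
      fun t => [t.1, t.2.1, t.2.2]).flatMap fun w => w ++ [CodeSymbol.comma] := by
    simp [codeEdges, codeList, edgeWords, List.flatMap_map, List.flatMap_assoc]
  rw [this, split_flatMap, group_flatMap]
  intro w hw h
  obtain ⟨t, ht, hw⟩ := List.mem_flatMap.1 hw
  obtain ⟨e, _, rfl⟩ := List.mem_map.1 ht
  simp only [edgeWords, List.mem_cons, List.not_mem_nil, or_false] at hw
  rcases hw with rfl | rfl | rfl
  · simpa using mem_codeNat h
  · simpa using mem_codeNat h
  · simpa using mem_codeLabel h

/-- Inputs are presented to programs by their codes in reverse order. -/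
instance : Enc NextLabelInput := ⟨fun I => enc I.code.reverse⟩

theorem polyTime_parts : PolyTime fun I : NextLabelInput =>
    split .bar (I.code ++ [CodeSymbol.bar]) := by
  have h : PolyTime fun I : NextLabelInput => I.code.reverse := .recode fun _ => rfl
  have h' : PolyTime fun I : NextLabelInput => I.code := h.reverse.of_eq fun I => by simp
  fun_prop

/-- Splitting at commas gives the list of numerals, which has the same tree code as the list of
numbers. -/
theorem polyTime_of_codeList {l : X → List ℕ} (h : PolyTime fun x => codeList (l x)) :
    PolyTime l :=
  (polyTime_split .comma h).of_enc_eq fun x => by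
    rw [split_codeList, ← List.map_id (l x)]
    conv_rhs => rw [List.map_id]
    exact enc_map_congr (f := id) (g := codeNat) (fun _ => rfl) (l x)

theorem polyTime_sets : PolyTime fun I : NextLabelInput => I.sets := by
  have hp := polyTime_parts
  have h : PolyTime fun I : NextLabelInput => codeSets I.sets :=
    PolyTime.of_eq (f := fun I : NextLabelInput =>
      (split .bar (I.code ++ [CodeSymbol.bar])).tail.tail.tail.headD []) (by fun_prop) fun I => by
        rw [split_code]; rfl
  have h' : PolyTime fun I : NextLabelInput => I.sets.map codeList :=
    (polyTime_split .semicolon h).of_eq fun I => (split_codeSets _).symm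
  refine PolyTime.of_enc_eq (f := fun I : NextLabelInput =>
    (I.sets.map codeList).map (split .comma)) ?_ fun I => ?_
  · exact h'.map (polyTime_split _ .snd)
  · rw [List.map_map]
    conv_lhs => rw [← List.map_id I.sets]
    refine enc_map_congr (fun l => ?_) _
    simp only [Function.comp, split_codeList]
    conv_lhs => rw [id, ← List.map_id l]
    exact enc_map_congr (f := id) (g := codeNat) (fun _ => rfl) l

theorem polyTime_vertices : PolyTime fun I : NextLabelInput => List.range I.numVertices := by
  have hp := polyTime_parts
  refine polyTime_of_codeList (PolyTime.of_eq (f := fun I : NextLabelInput =>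
      (split .bar (I.code ++ [CodeSymbol.bar])).headD []) (by fun_prop) fun I => ?_)
  rw [split_code]; rfl

theorem polyTime_ends : PolyTime fun I : NextLabelInput =>
    [(I.graph.start : ℕ), (I.graph.terminal : ℕ)] := by
  have hp := polyTime_parts
  refine polyTime_of_codeList (PolyTime.of_eq (f := fun I : NextLabelInput =>
      (split .bar (I.code ++ [CodeSymbol.bar])).tail.headD []) (by fun_prop) fun I => ?_)
  rw [split_code]; rfl

theorem polyTime_edges : PolyTime fun I : NextLabelInput =>
    (List.finRange I.numEdges).map (edge I.graph) := by
  have hp := polyTime_parts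
  have h : PolyTime fun I : NextLabelInput => codeEdges I.graph :=
    PolyTime.of_eq (f := fun I : NextLabelInput =>
      (split .bar (I.code ++ [CodeSymbol.bar])).tail.tail.headD []) (by fun_prop) fun I => by
        rw [split_code]; rfl
  refine PolyTime.of_enc_eq (f := fun I : NextLabelInput =>
    (group (split .comma (codeEdges I.graph))).map fun t : Word × Word × Word =>
      -- Numerals contain only bits, so the word `[empty]` identifies an unlabelled edge
      -- unambiguously.
      (t.1, t.2.1, if t.2.2 = [CodeSymbol.empty] then none else some t.2.2)) ?_ fun I => ?_
  · have h₁ : PolyTime fun t : NextLabelInput × Word × Word × Word => some t.2.2.2 :=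
      polyTime_some (by fun_prop)
    fun_prop
  · rw [group_split_codeEdges, List.map_map]
    refine enc_map_congr (fun e => ?_) _
    have : enc (I.graph.label e) = enc (if codeLabel (I.graph.label e) = [CodeSymbol.empty]
        then none else some (codeLabel (I.graph.label e))) := by
      cases I.graph.label e with
      | none => rfl
      | some u =>
        rw [if_neg]
        · rfl
        · intro h
          have : CodeSymbol.empty ∈ codeNat u := by
            change codeNat u = _ at h
            simp [h]
          simpa using mem_codeNat this
    simp only [Function.comp, edgeWords, edge]
    change StackProgram.Tree.node _ (.node _ _) = StackProgram.Tree.node _ (.node _ _)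
    rw [this]
    rfl

theorem polyTime_net : PolyTime net := by
  have hE := polyTime_edges
  have hV := polyTime_vertices
  have hst := polyTime_ends
  have hs : PolyTime fun I : NextLabelInput => (I.graph.start : ℕ) :=
    (hst.headD (.const 0)).of_eq fun _ => rfl
  have ht : PolyTime fun I : NextLabelInput => (I.graph.terminal : ℕ) :=
    (hst.tail.headD (.const 0)).of_eq fun _ => rfl
  have hE' : PolyTime fun I : NextLabelInput => edges I.graph := by
    unfold edges
    fun_prop
  have hR : PolyTime fun I : NextLabelInput => (List.range I.numVertices).flatMap fun _ =>
      (edges I.graph).map fun _ => () :=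
    hV.flatMap (f := fun I _ => (edges I.graph).map fun _ => ())
      ((hE'.comp .fst).map (f := fun _ _ => ()) (.const ()))
  exact hE'.pair (hR.pair (hs.pair ht))

/-! ## Input, output and the final machine -/

/-- The symbols in the order of their indices. -/
def alphabet : List CodeSymbol := [.zero, .one, .comma, .semicolon, .bar, .empty]

/-- Move a symbol from the input stack to the list on the main stack. -/
def loadSymbol (L : List CodeSymbol) : Cmd :=
  L.foldr (fun a c => .ite .io (fun o => decide (o = some a))
    (.seq (pushWord (code a)) (.seq (.push .main .one) (.move .io []))) c) .skip

theorem runs_loadSymbol (L : List CodeSymbol) (a : CodeSymbol) (h : a ∈ L) (w m : Word) :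
    RunsLe (loadSymbol L) (store (a :: w) m [] [] [])
      (store w (.one :: (code a ++ m)) [] [] []) (L.length + 14) := by
  induction L with
  | nil => simp at h
  | cons b L ih =>
    by_cases hab : a = b
    · subst hab
      have h₁ := runs_pushWord (a :: w) (code a) m
      have h₂ := Runs.push .main .one (store (a :: w) (code a ++ m) [] [] [])
      have h₃ := Runs.move_cons .io [] (store (a :: w) (.one :: (code a ++ m)) [] [] []) a w rfl
      rw [update_store_main] at h₂
      rw [update_store_io, pushAll] at h₃
      refine (Runs.ite_true (k := .io) (by simp) (h₁.seq (h₂.seq h₃))).le ?_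
      have := size_symbol_le a
      rw [length_code, List.length_cons]
      omega
    · refine (RunsLe.ite_false (k := .io) (by simp [hab])
        (ih ((List.mem_cons.1 h).resolve_left hab))).mono ?_
      rw [List.length_cons]

/-- Read the input. -/
def load : Cmd := .seq (.push .main .zero) (.loop .io Option.isSome (loadSymbol alphabet))

theorem mem_alphabet (a : CodeSymbol) : a ∈ alphabet := by cases a <;> decide

/-- Symbols are consed in reading order, which reverses the word; the encoding of `NextLabelInput`
allows for this. -/
theorem runs_load (w : Word) :
    RunsLe load (store w [] [] [] []) (vals (code w.reverse)) (21 * w.length + 2) := by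
  have key : ∀ (w l : Word), RunsLe (.loop .io Option.isSome (loadSymbol alphabet))
      (store w (code l) [] [] []) (vals (code (w.reverse ++ l))) (21 * w.length + 1) := by
    intro w
    induction w with
    | nil => intro l; exact (Runs.loop_exit rfl).le le_rfl
    | cons a w ih =>
      intro l
      have h := ih (a :: l)
      rw [code_cons] at h
      rw [List.reverse_cons, List.append_assoc]
      refine (RunsLe.loop_step rfl (runs_loadSymbol alphabet a (mem_alphabet a) w _) h).mono ?_
      simp only [alphabet, List.length_cons, List.length_nil]
      omega
  have h := Runs.push .main .zero (store w [] [] [] [])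
  rw [update_store_main] at h
  have h' := key w []
  rw [List.append_nil] at h'
  exact ((h.le le_rfl).seq h').mono (by omega)

/-- Move the unary code of an index from the main stack and push the symbol of the list `L` with
this index on the output stack. -/
def emitSymbol : List CodeSymbol → Cmd
  | [] => .skip
  | a :: L => .ite .main isOne (.seq pop (.seq pop (emitSymbol L))) (.seq pop (.push .io a))

theorem runs_pop_main (i : Word) (a : CodeSymbol) (m : Word) :
    RunsLe pop (store i (a :: m) [] [] []) (store i m [] [] []) 1 := by
  have e := Runs.move_cons .main [] (store i (a :: m) [] [] []) a m rfl
  rw [update_store_main] at e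
  exact e.le le_rfl

/-- Each unit of the index is coded by `one`, `zero`; a test and two pops give three steps per unit.
-/
theorem runs_emitSymbol (L : List CodeSymbol) (n : ℕ) (h : n < L.length) (i m : Word) :
    RunsLe (emitSymbol L) (store i (code (List.replicate n ()) ++ m) [] [] [])
      (store (L[n] :: i) m [] [] []) (3 * n + 3) := by
  induction L generalizing n with
  | nil => simp at h
  | cons a L ih =>
    cases n with
    | zero =>
      have e := Runs.push .io a (store i m [] [] [])
      rw [update_store_io] at e
      exact (RunsLe.ite_false (k := .main) (p := isOne) rfl
        ((runs_pop_main i .zero m).seq (e.le le_rfl)))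
    | succ n =>
      have h' := ih n (by simpa using h)
      exact (RunsLe.ite_true (k := .main) (p := isOne) rfl
        ((runs_pop_main i .one _).seq ((runs_pop_main i .zero _).seq h'))).mono (by omega)

/-- Write a list of symbols, in reverse order, on the output stack. -/
def emit : Cmd := .seq (.loop .main isOne (.seq pop (emitSymbol alphabet))) pop

/-- Emission reverses the word, so the main program computes the reversed answer. The `20` is a loop
test, a pop and at most `3 * 5 + 3` steps. -/
theorem runs_emit (l : Word) :
    RunsLe emit (vals (code l)) (store l.reverse [] [] [] []) (20 * l.length + 2) := by
  have key : ∀ (l i : Word), RunsLe (.loop .main isOne (.seq pop (emitSymbol alphabet)))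
      (store i (code l) [] [] []) (store (l.reverse ++ i) [.zero] [] [] [])
      (20 * l.length + 1) := by
    intro l
    induction l with
    | nil => intro i; exact (Runs.loop_exit rfl).le le_rfl
    | cons a l ih =>
      intro i
      have hlt : symbolIndex a < alphabet.length := by cases a <;> decide
      have hget : alphabet[symbolIndex a] = a := by cases a <;> rfl
      have h := runs_emitSymbol alphabet (symbolIndex a) hlt i (code l)
      rw [hget] at h
      rw [List.reverse_cons, List.append_assoc]
      refine (RunsLe.loop_step (k := .main) (p := isOne) rfl
        ((runs_pop_main i .one _).seq h) (ih (a :: i))).mono ?_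
      have : symbolIndex a ≤ 5 := by cases a <;> decide
      rw [List.length_cons]
      omega
  have h := key l []
  rw [List.append_nil] at h
  exact (h.seq (runs_pop_main l.reverse .zero [])).mono (by omega)

theorem computable_answer : Nonempty (Turing.TM2ComputableInPolyTime NextLabelInput.code codeAnswer
    fun I => answer (net I) I.sets) := by
  have h : PolyTime fun I : NextLabelInput => (codeAnswer (answer (net I) I.sets)).reverse :=
    (polyTime_codeAnswer (polyTime_answer polyTime_net polyTime_sets)).reverse
  obtain ⟨q, hq⟩ := h.size_bdd
  obtain ⟨c, g, ⟨p, hp⟩, hr⟩ := h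
  -- Converts word length into tree size: a symbol has size at most 11, plus 1 for its list node.
  let r : Polynomial ℕ := 12 * Polynomial.X + 1
  refine computable_of_runs _ _ _ (.seq load (.seq c emit))
    (21 * Polynomial.X + 2 + (p.comp r + (20 * q.comp r + 2))) fun I => ?_
  have hsize : size I ≤ r.eval I.code.length := by
    have : size I ≤ 12 * I.code.reverse.length + 1 := size_word_le I.code.reverse
    simpa [r] using this
  have h₁ := hr I []
  rw [List.append_nil, List.append_nil] at h₁
  have h₂ := runs_emit (codeAnswer (answer (net I) I.sets)).reverse
  rw [List.reverse_reverse] at h₂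
  refine ((runs_load I.code).seq (h₁.seq h₂)).mono ?_
  have h₃ := (hp I).trans (eval_mono p hsize)
  have h₄ := (length_le_size _).trans ((hq I).trans (eval_mono q hsize))
  simp only [Polynomial.eval_add, Polynomial.eval_mul, Polynomial.eval_comp, Polynomial.eval_X,
    Polynomial.eval_ofNat]
  omega

end NextLabel

theorem mainTheorem4 :
    ∃ f : NextLabelInput → Option (List ℕ),
      Nonempty (Turing.TM2ComputableInPolyTime NextLabelInput.code codeAnswer f) ∧
        ∀ I : NextLabelInput, I.IsAnswer (f I) := by
  exact ⟨fun I => NextLabel.answer (NextLabel.net I) I.sets, NextLabel.computable_answer,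
    NextLabel.isAnswer_answer⟩
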